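/- Let $f:\mathbb R\to\mathbb R$ be smooth, and let $\rho_0,u_0\in C^1_b(\mathbb R)$ with $\rho_0\ge 0$ (here $C^k_b(\mathbb R)$ is the set of $C^k$ functions that are bounded together with their derivatives up to order $k$). Let $0<T<\infty$ and let $(\rho,u)$ be a classical solution on $[0,T)\times\mathbb R$ of $$\rho_t+(\rho f(u))_x=0,\qquad u_t+uu_x=\rho\,(f(u)-u),\qquad (\rho,u)(0,\cdot)=(\rho_0,u_0),$$ that is, $\rho,u\in C^1([0,T)\times\mathbb R)$, and $\rho,u,\rho_x,u_x$ are bounded on $[0,\tau]\times\mathbb R$ for every $\tau<T$. Assume $f_u\le 0$ at all values taken by $u$. Put $e:=u_x+\rho$ and $e_0:=u_{0x}+\rho_0$. (1) If $\rho_0(x),e_0(x)\in[0,M]$ for all $x\in\mathbb R$, then $\rho(t,x),e(t,x)\in[0,M]$ for all $t\in[0,T)$, $x\in\mathbb R$. (If $\rho_0,e_0\ge0$, one may take $M=\max\{\sup\rho_0,\sup e_0\}$.) (2) Suppose $e_0(x^*)<0$ for some $x^*\in\mathbb R$. Then $T\le -1/e_0(x^*)$; in particular no classical solution exists for all times. Suppose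 in addition that $u_0\in C^2_b(\mathbb R)$ and $e\in C^1([0,T)\times\mathbb R)$. (2a) If $(\rho,u)$ has no continuation to a solution on $[0,T]\times\mathbb R$ such that $\rho,u,u_x+\rho$ are $C^1$ there and $\rho,u,\rho_x,u_x$ are bounded there, then $\inf_{x\in\mathbb R}e(t,x)\to-\infty$ as $t\to T^-$. (2b) If $(\rho,u)$ loses its $C^1$ smoothness at time $t_c:=T$, in the sense that it has no continuation, bounded or not, to a solution on $[0,T]\times\mathbb R$ such that $\rho,u,u_x+\rho$ are $C^1$ there, then there is $x_c\in\mathbb R$ with $\lim_{t\to t_c^-}e(t,x_c)=-\infty$; moreover there is a characteristic $X:[0,t_c)\to\mathbb R$, $X'(t)=u(t,X(t))$, such that $X(t)\to x_c$ and $e(t,X(t))\to-\infty$ as $t\to t_c^-$. -/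

import Mathlib

open Set Filter
open scoped Topology ContDiff

/-- `C_b^k(ℝ)`: the `k` times continuously differentiable functions that are bounded together with
all their derivatives up to order `k`. -/
def IsCb (k : ℕ) (g : ℝ → ℝ) : Prop :=
  ContDiff ℝ k g ∧ ∀ i ≤ k, ∃ C : ℝ, ∀ x, |iteratedDeriv i g x| ≤ C

/-- The quantity `e = u_x + ρ`; the arguments of `ρ` and `u` are time and space, in this order. -/
noncomputable def eField (ρ u : ℝ → ℝ → ℝ) (t x : ℝ) : ℝ :=
  deriv (u t) x + ρ t x

/-- `g = g(t, x)` is of class `C^1` on `J × ℝ`, up to the end points that the time interval `J`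
contains. -/
def IsC1On (J : Set ℝ) (g : ℝ → ℝ → ℝ) : Prop :=
  ContDiffOn ℝ 1 (fun p : ℝ × ℝ => g p.1 p.2) (J ×ˢ univ)

/-- `(ρ, u)` is a `C^1` solution on `J × ℝ` of
`ρ_t + (ρ f(u))_x = 0`, `u_t + u u_x = ρ (f(u) - u)`.
As `ρ` and `u` are `C^1` on `J × ℝ`, the equations are required at interior times only. -/
structure IsC1Solution (f : ℝ → ℝ) (J : Set ℝ) (ρ u : ℝ → ℝ → ℝ) : Prop where
  c1_rho : IsC1On J ρ
  c1_u : IsC1On J u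
  mass : ∀ t ∈ interior J, ∀ x,
    deriv (fun s => ρ s x) t + deriv (fun y => ρ t y * f (u t y)) x = 0
  velocity : ∀ t ∈ interior J, ∀ x,
    deriv (fun s => u s x) t + u t x * deriv (u t) x = ρ t x * (f (u t x) - u t x)

/-- `ρ, u, ρ_x, u_x` are bounded on `[0, τ] × ℝ` for every `τ ∈ J`. -/
def IsLocallyBoundedC1 (J : Set ℝ) (ρ u : ℝ → ℝ → ℝ) : Prop :=
  ∀ τ ∈ J, ∃ B : ℝ, ∀ t ∈ Icc 0 τ, ∀ x,
    |ρ t x| ≤ B ∧ |u t x| ≤ B ∧ |deriv (ρ t) x| ≤ B ∧ |deriv (u t) x| ≤ B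

/-- Classical solution on `[0, T) × ℝ` of the Cauchy problem with data `(ρ₀, u₀)`. -/
structure IsClassicalSolution (f ρ₀ u₀ : ℝ → ℝ) (T : ℝ) (ρ u : ℝ → ℝ → ℝ) : Prop where
  sol : IsC1Solution f (Ico 0 T) ρ u
  bdd : IsLocallyBoundedC1 (Ico 0 T) ρ u
  init_rho : ρ 0 = ρ₀
  init_u : u 0 = u₀

/-- `(ρ', u')` continues `(ρ, u)` from `[0, T) × ℝ` to a solution on `[0, T] × ℝ` for which
`ρ'`, `u'` and `u'_x + ρ'` are `C^1`. -/
structure IsC1Continuation (f : ℝ → ℝ) (T : ℝ) (ρ u ρ' u' : ℝ → ℝ → ℝ) : Prop where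
  eq_rho : ∀ t ∈ Ico 0 T, ρ' t = ρ t
  eq_u : ∀ t ∈ Ico 0 T, u' t = u t
  sol : IsC1Solution f (Icc 0 T) ρ' u'
  c1_e : IsC1On (Icc 0 T) (eField ρ' u')

/-- `(ρ, u)` cannot be continued up to the time `T` included as a solution that is `C^1`
(with `u_x + ρ` also `C^1`) and bounded together with `ρ_x`, `u_x`. -/
def IsMaximalBounded (f : ℝ → ℝ) (T : ℝ) (ρ u : ℝ → ℝ → ℝ) : Prop :=
  ¬ ∃ ρ' u' : ℝ → ℝ → ℝ, IsC1Continuation f T ρ u ρ' u' ∧ IsLocallyBoundedC1 (Icc 0 T) ρ' u'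

/-- `(ρ, u)` loses its `C^1` smoothness at the time `T`: it has no continuation whatsoever,
bounded or not, to a `C^1` solution (with `u_x + ρ` also `C^1`) on `[0, T] × ℝ`. -/
def BreaksDownAt (f : ℝ → ℝ) (T : ℝ) (ρ u : ℝ → ℝ → ℝ) : Prop :=
  ¬ ∃ ρ' u' : ℝ → ℝ → ℝ, IsC1Continuation f T ρ u ρ' u'

/-- `X` is a characteristic `dX/dt = u(t, X)` on `[0, T)`. -/
def IsCharacteristic (u : ℝ → ℝ → ℝ) (T : ℝ) (X : ℝ → ℝ) : Prop :=
  ∀ t ∈ Ico 0 T, HasDerivWithinAt X (u t (X t)) (Ico 0 T) t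

/-!
Along the characteristics `X' = u(t, X)` the quantity `e = u_x + ρ` satisfies `e' = e (ρ - e)`, and
along the curves `Y' = f(u(t, Y))` the density satisfies `ρ' = f'(u) ρ (ρ - e)`. As `f' ≤ 0`, both
right-hand sides are nonpositive for the larger one of `ρ` and `e`, and `0` is a barrier: this is
the invariance of `[0, M]`. The equation of `e` involves a second derivative of `u`, which need not
exist. It is obtained from `IsTransported.space_deriv`, which differentiates a transport equation
in space by differentiating its integrated form with respect to the starting point of the
characteristic. The maximum principle is `le_of_transported_of_source_lt`: the maximum over a
compact backward cone is attained, and there the derivative along the relevant characteristic has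
a sign.

Let `P = exp (∫ u_x)` be the factor by which the flow of `u` stretches space along a characteristic.
Then `e P` is constant in time, and `P' = e₀ - ρ P`. As `ρ ≥ 0` and `P > 0`, this gives
`0 < 1 + e₀ t` for all `t < T`, which bounds the lifespan.

If `e` is also `C^1`, then `ρ_x` and `e_x` solve equations that are linear in these quantities, along
the two families of characteristics, so that the maximum principle bounds them wherever `e` is
bounded below (`IsControlledSolution.exists_bound`; the bounds of `ρ`, `u` and of `e` from above hold
up to the time `T` in any case). A transported quantity with a bounded source has limits at the time
`T` (`exists_tendsto_of_transported`). Applied to `ρ`, `u`, `e`, `ρ_x` and `e_x`, this gives a `C^1`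
continuation (`IsC1Solution.exists_continuation`). Negative values of `e` decrease along
characteristics, so if `inf e` does not tend to `-∞`, then `e` is bounded below and a bounded
continuation exists.

If there is no continuation at all, then `e` is unbounded below on the domain of dependence of some
interval. Since `e P = e₀`, the stretching `P` comes close to `0` there. The linear equation of `P`
makes `P` Lipschitz in time uniformly in the characteristic, so by compactness there is a
characteristic on which `P → 0`, that is, `e → -∞`. For its end point `xc`, consider the
characteristics through `(t, xc)` as `t → T`: their starting points accumulate only at points whose
characteristics end in `xc`. On these `P → 0` too, because a nontrivial interval of starting points
would be compressed to the point `xc`. Hence `e(t, xc) → -∞`.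
-/

/-! ### Characteristics -/

/-- The half-open time strip `[0, T) × ℝ`. -/
def strip (T : ℝ) : Set (ℝ × ℝ) := Ico 0 T ×ˢ univ

@[simp] lemma mem_strip {T : ℝ} {p : ℝ × ℝ} : p ∈ strip T ↔ p.1 ∈ Ico 0 T := by
  simp [strip]

/-- `w` is continuous on `[0, T) × ℝ` together with its space derivative. -/
structure IsC1InSpace (T : ℝ) (w : ℝ → ℝ → ℝ) : Prop where
  cont : ContinuousOn (fun p : ℝ × ℝ => w p.1 p.2) (strip T)
  diff : ∀ t ∈ Ico 0 T, Differentiable ℝ (w t)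
  cont_deriv : ContinuousOn (fun p : ℝ × ℝ => deriv (w p.1) p.2) (strip T)

/-- A velocity field whose characteristics exist on all of `[0, T)`: it is continuous with its space
derivative, and both are bounded on `[0, τ] × ℝ` for every `τ < T`. -/
structure IsSpeed (T : ℝ) (v : ℝ → ℝ → ℝ) : Prop extends IsC1InSpace T v where
  bdd : ∀ τ ∈ Ico 0 T, ∃ B : ℝ, ∀ t ∈ Icc 0 τ, ∀ x, |v t x| ≤ B ∧ |deriv (v t) x| ≤ B

/-- Along every characteristic of the velocity field `v`, the derivative of `w` is `h`: the form
of `w_t + v w_x = h` that makes sense for `w` without derivatives. -/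
def IsTransported (T : ℝ) (v w h : ℝ → ℝ → ℝ) : Prop :=
  ∀ Z, IsCharacteristic v T Z → ∀ t ∈ Ico 0 T,
    HasDerivWithinAt (fun s => w s (Z s)) (h t (Z t)) (Ico 0 T) t

/-- Grönwall's inequality in the form in which a bound of `D D'` from one side is enough, so that it
needs no bound of `|D'|`. -/
lemma abs_le_exp_mul_abs_left {D D' : ℝ → ℝ} {L s t : ℝ} (hst : s ≤ t)
    (hD : ∀ r ∈ Icc s t, HasDerivWithinAt D (D' r) (Icc s t) r)
    (h : ∀ r ∈ Icc s t, D r * D' r ≤ L * D r ^ 2) :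
    |D t| ≤ Real.exp (L * (t - s)) * |D s| := by
  have key : AntitoneOn (fun r => D r ^ 2 * Real.exp (-(2 * L * r))) (Icc s t) := by
    have hd : ∀ r ∈ Icc s t, HasDerivWithinAt (fun r => D r ^ 2 * Real.exp (-(2 * L * r)))
        (2 * (D r * D' r - L * D r ^ 2) * Real.exp (-(2 * L * r))) (Icc s t) r := by
      intro r hr
      have h1 := (hD r hr).pow 2
      have h2 : HasDerivWithinAt (fun r : ℝ => Real.exp (-(2 * L * r)))
          (Real.exp (-(2 * L * r)) * (-(2 * L * 1))) (Icc s t) r :=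
        (((hasDerivAt_id r).const_mul (2 * L)).neg.exp).hasDerivWithinAt
      refine (h1.mul h2).congr_deriv ?_
      simp; ring
    refine antitoneOn_of_hasDerivWithinAt_nonpos (convex_Icc s t)
      (fun r hr => (hd r hr).continuousWithinAt)
      (fun r hr => (hd r (interior_subset hr)).mono interior_subset) fun r hr => ?_
    have := h r (interior_subset hr)
    exact mul_nonpos_of_nonpos_of_nonneg (by linarith) (Real.exp_pos _).le
  have h1 := key (left_mem_Icc.2 hst) (right_mem_Icc.2 hst) hst
  refine abs_le_of_sq_le_sq ?_ (by positivity)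
  rw [mul_pow, sq_abs, ← Real.exp_nat_mul]
  have h2 : Real.exp ((2 : ℕ) * (L * (t - s)))
      = Real.exp (-(2 * L * s)) * Real.exp (2 * L * t) := by
    rw [← Real.exp_add]; congr 1; push_cast; ring
  have h3 : Real.exp (-(2 * L * t)) * Real.exp (2 * L * t) = 1 := by
    rw [← Real.exp_add]; simp
  have h4 := mul_le_mul_of_nonneg_right h1 (Real.exp_pos (2 * L * t)).le
  simp only at h4
  rw [mul_assoc, h3, mul_one] at h4
  rw [h2]; linarith

/-- Grönwall's inequality backwards in time. -/
lemma abs_le_exp_mul_abs_right {D D' : ℝ → ℝ} {L s t : ℝ} (hst : s ≤ t)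
    (hD : ∀ r ∈ Icc s t, HasDerivWithinAt D (D' r) (Icc s t) r)
    (h : ∀ r ∈ Icc s t, -(L * D r ^ 2) ≤ D r * D' r) :
    |D s| ≤ Real.exp (L * (t - s)) * |D t| := by
  have hneg : MapsTo (fun r : ℝ => -r) (Icc (-t) (-s)) (Icc s t) := fun r hr =>
    ⟨by linarith [hr.2], by linarith [hr.1]⟩
  have := abs_le_exp_mul_abs_left (D := fun r => D (-r)) (D' := fun r => -(D' (-r))) (L := L)
    (neg_le_neg hst) (fun r hr => ?_) fun r hr => ?_
  · simp only [neg_neg] at this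
    convert this using 3
    ring
  · refine ((hD (-r) (hneg hr)).comp r (hasDerivAt_neg r).hasDerivWithinAt hneg).congr_deriv ?_
    ring
  · have := h (-r) (hneg hr)
    linarith

lemma abs_image_sub_le_of_abs_deriv_le {g : ℝ → ℝ} {C : ℝ} {s : Set ℝ} (hs : Convex ℝ s)
    (hg : Differentiable ℝ g) (hC : ∀ x ∈ s, |deriv g x| ≤ C) {x y : ℝ} (hx : x ∈ s) (hy : y ∈ s) :
    |g y - g x| ≤ C * |y - x| := by
  simpa [Real.norm_eq_abs] using
    hs.norm_image_sub_le_of_norm_deriv_le (fun z _ => hg z) (by simpa using hC) hx hy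

/-- A bound of the space derivative of `v` along two characteristics controls, in both
directions of time, how fast they separate. -/
lemma abs_sub_le_of_abs_deriv_le {v : ℝ → ℝ → ℝ} {L s t : ℝ} (hst : s ≤ t) {A : ℝ → Set ℝ}
    {Z W : ℝ → ℝ} (hZ : ∀ r ∈ Icc s t, HasDerivWithinAt Z (v r (Z r)) (Icc s t) r)
    (hW : ∀ r ∈ Icc s t, HasDerivWithinAt W (v r (W r)) (Icc s t) r)
    (hv : ∀ r ∈ Icc s t, Differentiable ℝ (v r)) (hA : ∀ r ∈ Icc s t, Convex ℝ (A r))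
    (hL : ∀ r ∈ Icc s t, ∀ x ∈ A r, |deriv (v r) x| ≤ L)
    (hZA : ∀ r ∈ Icc s t, Z r ∈ A r) (hWA : ∀ r ∈ Icc s t, W r ∈ A r) :
    |Z t - W t| ≤ Real.exp (L * (t - s)) * |Z s - W s| ∧
      |Z s - W s| ≤ Real.exp (L * (t - s)) * |Z t - W t| := by
  have hD : ∀ r ∈ Icc s t, HasDerivWithinAt (fun r => Z r - W r) (v r (Z r) - v r (W r))
      (Icc s t) r := fun r hr => (hZ r hr).sub (hW r hr)
  have hb : ∀ r ∈ Icc s t, |(Z r - W r) * (v r (Z r) - v r (W r))| ≤ L * (Z r - W r) ^ 2 := by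
    intro r hr
    have := abs_image_sub_le_of_abs_deriv_le (hA r hr) (hv r hr) (hL r hr) (hWA r hr) (hZA r hr)
    rw [abs_mul, ← sq_abs (Z r - W r)]
    nlinarith [abs_nonneg (Z r - W r)]
  exact ⟨abs_le_exp_mul_abs_left hst hD fun r hr => (abs_le.1 (hb r hr)).2,
    abs_le_exp_mul_abs_right hst hD fun r hr => (abs_le.1 (hb r hr)).1⟩

lemma eqOn_of_eq_at {v : ℝ → ℝ → ℝ} {T τ t₁ : ℝ} (hv : IsSpeed T v) (hτ : τ ∈ Ico 0 T)
    {Z W : ℝ → ℝ} (hZ : ∀ r ∈ Icc 0 τ, HasDerivWithinAt Z (v r (Z r)) (Icc 0 τ) r)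
    (hW : ∀ r ∈ Icc 0 τ, HasDerivWithinAt W (v r (W r)) (Icc 0 τ) r) (ht₁ : t₁ ∈ Icc 0 τ)
    (h : Z t₁ = W t₁) : EqOn Z W (Icc 0 τ) := by
  obtain ⟨B, hB⟩ := hv.bdd τ hτ
  have key : ∀ s t, 0 ≤ s → s ≤ t → t ≤ τ → (Z s = W s ↔ Z t = W t) := by
    intro s t hs hst ht
    have hsub : Icc s t ⊆ Icc 0 τ := Icc_subset_Icc hs ht
    have := abs_sub_le_of_abs_deriv_le (L := B) (A := fun _ => univ) hst
      (fun r hr => (hZ r (hsub hr)).mono hsub) (fun r hr => (hW r (hsub hr)).mono hsub)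
      (fun r hr => hv.diff r ⟨(hsub hr).1, (hsub hr).2.trans_lt hτ.2⟩) (fun _ _ => convex_univ)
      (fun r hr x _ => (hB r (hsub hr) x).2) (fun _ _ => mem_univ _) (fun _ _ => mem_univ _)
    constructor
    · intro h; have := this.1; rw [h] at this; simpa [sub_eq_zero] using this
    · intro h; have := this.2; rw [h] at this; simpa [sub_eq_zero] using this
  intro r hr
  rcases le_total r t₁ with h' | h'
  · exact (key r t₁ hr.1 h' ht₁.2).2 h
  · exact (key t₁ r ht₁.1 h' hr.2).1 h

lemma Icc_mem_nhdsWithin_Ico {T τ t : ℝ} (h : t < τ) : Icc 0 τ ∈ 𝓝[Ico 0 T] t := by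
  filter_upwards [self_mem_nhdsWithin, mem_nhdsWithin_of_mem_nhds (Iio_mem_nhds h)] with r h1 h2
  exact ⟨h1.1, le_of_lt h2⟩

lemma IsCharacteristic.hasDerivWithinAt_Icc {v : ℝ → ℝ → ℝ} {T s t r : ℝ} {Z : ℝ → ℝ}
    (hZ : IsCharacteristic v T Z) (hs : 0 ≤ s) (ht : t < T) (hr : r ∈ Icc s t) :
    HasDerivWithinAt Z (v r (Z r)) (Icc s t) r :=
  (hZ r ⟨hs.trans hr.1, hr.2.trans_lt ht⟩).mono fun _ h => ⟨hs.trans h.1, h.2.trans_lt ht⟩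

lemma IsCharacteristic.continuousOn {v : ℝ → ℝ → ℝ} {T : ℝ} {Z : ℝ → ℝ}
    (hZ : IsCharacteristic v T Z) : ContinuousOn Z (Ico 0 T) :=
  fun t ht => (hZ t ht).continuousWithinAt

lemma IsSpeed.eqOn {v : ℝ → ℝ → ℝ} {T t₁ : ℝ} (hv : IsSpeed T v) {Z W : ℝ → ℝ}
    (hZ : IsCharacteristic v T Z) (hW : IsCharacteristic v T W) (ht₁ : t₁ ∈ Ico 0 T)
    (h : Z t₁ = W t₁) : EqOn Z W (Ico 0 T) := by
  intro r hr
  have hm : max r t₁ < T := max_lt hr.2 ht₁.2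
  exact eqOn_of_eq_at hv ⟨hr.1.trans (le_max_left _ _), hm⟩
    (fun _ h => hZ.hasDerivWithinAt_Icc le_rfl hm h)
    (fun _ h => hW.hasDerivWithinAt_Icc le_rfl hm h) ⟨ht₁.1, le_max_right _ _⟩ h
    ⟨hr.1, le_max_left _ _⟩

lemma continuousOn_along {T : ℝ} {w : ℝ → ℝ → ℝ}
    (hw : ContinuousOn (fun p : ℝ × ℝ => w p.1 p.2) (strip T)) {Z : ℝ → ℝ}
    (hZ : ContinuousOn Z (Ico 0 T)) : ContinuousOn (fun t => w t (Z t)) (Ico 0 T) :=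
  hw.comp (f := fun t => (t, Z t)) (continuousOn_id.prodMk hZ) fun t ht => by simpa using ht

lemma IsSpeed.exists_solution_Icc {v : ℝ → ℝ → ℝ} {T τ t₁ : ℝ} (hv : IsSpeed T v)
    (hτ : τ ∈ Ico 0 T) (ht₁ : t₁ ∈ Icc 0 τ) (x₁ : ℝ) :
    ∃ Z : ℝ → ℝ, Z t₁ = x₁ ∧ ∀ r ∈ Icc 0 τ, HasDerivWithinAt Z (v r (Z r)) (Icc 0 τ) r := by
  obtain ⟨B, hB⟩ := hv.bdd τ hτ
  have hB0 : 0 ≤ B := (abs_nonneg _).trans (hB 0 ⟨le_rfl, hτ.1⟩ 0).1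
  have hsub : ∀ r ∈ Icc 0 τ, r ∈ Ico 0 T := fun r hr => ⟨hr.1, hr.2.trans_lt hτ.2⟩
  -- the radius `B τ` cannot be left within the time `τ`
  have hPL : IsPicardLindelof v (tmin := 0) (tmax := τ) ⟨t₁, ht₁⟩ x₁ (B * τ).toNNReal 0
      B.toNNReal B.toNNReal := by
    refine ⟨fun t ht => ?_, fun x _ => ?_, fun t ht x _ => ?_, ?_⟩
    · refine LipschitzOnWith.of_dist_le_mul fun x _ y _ => ?_
      rw [Real.dist_eq, Real.dist_eq, Real.coe_toNNReal _ hB0]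
      exact abs_image_sub_le_of_abs_deriv_le convex_univ (hv.diff t (hsub t ht))
        (fun z _ => (hB t ht z).2) (mem_univ _) (mem_univ _)
    · exact (continuousOn_along hv.cont continuousOn_const).mono hsub
    · rw [Real.norm_eq_abs, Real.coe_toNNReal _ hB0]; exact (hB t ht x).1
    · rw [Real.coe_toNNReal _ hB0, Real.coe_toNNReal _ (mul_nonneg hB0 hτ.1)]
      simp only [NNReal.coe_zero, sub_zero]
      refine mul_le_mul_of_nonneg_left (max_le ?_ ?_) hB0
      · linarith [ht₁.1]
      · exact ht₁.2
  exact hPL.exists_eq_forall_mem_Icc_hasDerivWithinAt₀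

/-- Through every point of `[0, T) × ℝ` there is a characteristic defined on all of `[0, T)`. -/
theorem IsSpeed.exists_characteristic {v : ℝ → ℝ → ℝ} {T t₁ : ℝ} (hv : IsSpeed T v)
    (ht₁ : t₁ ∈ Ico 0 T) (x₁ : ℝ) : ∃ Z, IsCharacteristic v T Z ∧ Z t₁ = x₁ := by
  have hex : ∀ τ, ∃ Z : ℝ → ℝ, τ ∈ Ico t₁ T → (Z t₁ = x₁ ∧
      ∀ r ∈ Icc 0 τ, HasDerivWithinAt Z (v r (Z r)) (Icc 0 τ) r) := by
    intro τ
    by_cases hτ : τ ∈ Ico t₁ T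
    · obtain ⟨Z, hZ⟩ := hv.exists_solution_Icc ⟨ht₁.1.trans hτ.1, hτ.2⟩ ⟨ht₁.1, hτ.1⟩ x₁
      exact ⟨Z, fun _ => hZ⟩
    · exact ⟨0, fun h => absurd h hτ⟩
  choose Z hZ using hex
  have hcomp : ∀ τ τ' r, τ ∈ Ico t₁ T → τ' ∈ Ico t₁ T → 0 ≤ r → r ≤ τ → r ≤ τ' →
      Z τ r = Z τ' r := by
    have : ∀ τ τ' r, τ ∈ Ico t₁ T → τ' ∈ Ico t₁ T → 0 ≤ r → r ≤ τ → τ ≤ τ' →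
        Z τ r = Z τ' r := by
      intro τ τ' r hτ hτ' hr hrτ hle
      have hsub : Icc 0 τ ⊆ Icc 0 τ' := Icc_subset_Icc le_rfl hle
      exact eqOn_of_eq_at hv ⟨ht₁.1.trans hτ.1, hτ.2⟩ (hZ τ hτ).2
        (fun s hs => ((hZ τ' hτ').2 s (hsub hs)).mono hsub) ⟨ht₁.1, hτ.1⟩
        ((hZ τ hτ).1.trans (hZ τ' hτ').1.symm) ⟨hr, hrτ⟩
    intro τ τ' r hτ hτ' hr h1 h2
    rcases le_total τ τ' with h | h
    · exact this τ τ' r hτ hτ' hr h1 h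
    · exact (this τ' τ r hτ' hτ hr h2 h).symm
  -- the solution on `[0, (max t t₁ + T) / 2]` is used at the time `t`
  set σ : ℝ → ℝ := fun t => (max t t₁ + T) / 2 with hσ
  have hσm : ∀ t ∈ Ico 0 T, σ t ∈ Ico t₁ T ∧ t < σ t := by
    intro t ht
    have h1 : max t t₁ < T := max_lt ht.2 ht₁.2
    have h2 := le_max_left t t₁
    have h3 := le_max_right t t₁
    refine ⟨⟨?_, ?_⟩, ?_⟩ <;> simp only [hσ] <;> linarith
  refine ⟨fun t => Z (σ t) t, fun t ht => ?_, ?_⟩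
  · obtain ⟨h1, h2⟩ := hσm t ht
    have hd := (hZ (σ t) h1).2 t ⟨ht.1, h2.le⟩
    have hd' := hd.mono_of_mem_nhdsWithin (Icc_mem_nhdsWithin_Ico (T := T) h2)
    refine hd'.congr_of_eventuallyEq ?_ rfl
    filter_upwards [self_mem_nhdsWithin, mem_nhdsWithin_of_mem_nhds (Iio_mem_nhds h2)] with r h3 h4
    exact hcomp _ _ r (hσm r h3).1 h1 h3.1 (hσm r h3).2.le (le_of_lt h4)
  · exact (hZ _ (hσm t₁ ht₁).1).1

lemma hasDerivWithinAt_primitive {T t : ℝ} {c : ℝ → ℝ} (hc : ContinuousOn c (Ico 0 T))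
    (ht : t ∈ Ico 0 T) : HasDerivWithinAt (fun t => ∫ s in (0)..t, c s) (c t) (Ico 0 T) t := by
  obtain ⟨τ, h1, h2⟩ := exists_between ht.2
  have hsub : Icc 0 τ ⊆ Ico 0 T := fun r hr => ⟨hr.1, hr.2.trans_lt h2⟩
  have hc' : ContinuousOn c (Icc 0 τ) := hc.mono hsub
  have hmem : t ∈ Icc 0 τ := ⟨ht.1, h1.le⟩
  have : Fact (t ∈ Icc 0 τ) := ⟨hmem⟩
  have : HasDerivWithinAt (fun t => ∫ s in (0)..t, c s) (c t) (Icc 0 τ) t := by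
    refine intervalIntegral.integral_hasDerivWithinAt_right (t := Icc 0 τ) ?_ ?_ (hc' t hmem)
    · exact (hc'.mono (by rw [uIcc_of_le ht.1]; exact Icc_subset_Icc le_rfl h1.le)).intervalIntegrable
    · exact hc'.stronglyMeasurableAtFilter_nhdsWithin measurableSet_Icc t
  exact this.mono_of_mem_nhdsWithin (Icc_mem_nhdsWithin_Ico h1)

lemma eq_of_hasDerivWithinAt_zero {T t : ℝ} {y : ℝ → ℝ}
    (hy : ∀ r ∈ Ico 0 T, HasDerivWithinAt y 0 (Ico 0 T) r) (ht : t ∈ Ico 0 T) : y t = y 0 := by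
  have hsub : Icc 0 t ⊆ Ico 0 T := fun r hr => ⟨hr.1, hr.2.trans_lt ht.2⟩
  refine constant_of_has_deriv_right_zero (a := 0) (b := t)
    (fun r hr => ((hy r (hsub hr)).mono hsub).continuousWithinAt) (fun r hr => ?_) t ⟨ht.1, le_rfl⟩
  have hr' : r ∈ Ico 0 T := hsub (Ico_subset_Icc_self hr)
  refine (hy r hr').mono_of_mem_nhdsWithin ?_
  filter_upwards [self_mem_nhdsWithin, mem_nhdsWithin_of_mem_nhds (Iio_mem_nhds hr'.2)] with q h1 h2
  exact ⟨hr'.1.trans h1, h2⟩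

lemma eq_add_integral {T t : ℝ} {y c : ℝ → ℝ} (hc : ContinuousOn c (Ico 0 T))
    (hy : ∀ r ∈ Ico 0 T, HasDerivWithinAt y (c r) (Ico 0 T) r) (ht : t ∈ Ico 0 T) :
    y t = y 0 + ∫ s in (0)..t, c s := by
  have := eq_of_hasDerivWithinAt_zero (y := fun t => y t - ∫ s in (0)..t, c s)
    (fun r hr => ((hy r hr).sub (hasDerivWithinAt_primitive hc hr)).congr_deriv (sub_self _)) ht
  simp at this
  linarith

/-- The solution of the linear equation `y' = c y`. -/
lemma eq_mul_exp_integral {T t : ℝ} {y c : ℝ → ℝ} (hc : ContinuousOn c (Ico 0 T))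
    (hy : ∀ r ∈ Ico 0 T, HasDerivWithinAt y (c r * y r) (Ico 0 T) r) (ht : t ∈ Ico 0 T) :
    y t = y 0 * Real.exp (∫ s in (0)..t, c s) := by
  have := eq_of_hasDerivWithinAt_zero (y := fun t => y t * Real.exp (-∫ s in (0)..t, c s))
    (fun r hr => ((hy r hr).mul (hasDerivWithinAt_primitive hc hr).neg.exp).congr_deriv
      (by ring)) ht
  simp [Real.exp_neg] at this
  rw [← this, mul_assoc, inv_mul_cancel₀ (Real.exp_pos _).ne', mul_one]

/-! ### Differentiating transport equations in space -/

open MeasureTheory in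
lemma aestronglyMeasurable_of_continuousOn_Ico {T t : ℝ} {c : ℝ → ℝ}
    (hc : ContinuousOn c (Ico 0 T)) (ht : t ∈ Ico 0 T) :
    AEStronglyMeasurable c (volume.restrict (uIoc 0 t)) := by
  rw [uIoc_of_le ht.1]
  exact (hc.mono fun r hr => ⟨hr.1.le, hr.2.trans_lt ht.2⟩).aestronglyMeasurable measurableSet_Ioc

lemma uIoc_subset_Ico {T t : ℝ} (ht : t ∈ Ico 0 T) {s : ℝ} (hs : s ∈ uIoc 0 t) :
    s ∈ Icc 0 t ∧ s ∈ Ico 0 T := by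
  rw [uIoc_of_le ht.1] at hs
  exact ⟨⟨hs.1.le, hs.2⟩, hs.1.le, hs.2.trans_lt ht.2⟩

section Flow

variable {T : ℝ} {v : ℝ → ℝ → ℝ} {Z : ℝ → ℝ → ℝ}

/-- Distinct characteristics separate at the exponential rate of the slope of `v` between them. -/
lemma flow_sub_eq (hv : IsSpeed T v) (hZ : ∀ b, IsCharacteristic v T (Z b))
    (hZ0 : ∀ b, Z b 0 = b) {t a b : ℝ} (ht : t ∈ Ico 0 T) (hab : b ≠ a) :
    ContinuousOn (fun s => (v s (Z b s) - v s (Z a s)) / (Z b s - Z a s)) (Ico 0 T) ∧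
    (∀ s ∈ Ico 0 T, Z b s ≠ Z a s) ∧
    Z b t - Z a t = (b - a) *
      Real.exp (∫ s in (0)..t, (v s (Z b s) - v s (Z a s)) / (Z b s - Z a s)) := by
  have hne : ∀ s ∈ Ico 0 T, Z b s ≠ Z a s := by
    intro s hs h
    have := hv.eqOn (hZ b) (hZ a) hs h ⟨le_rfl, hs.1.trans_lt hs.2⟩
    rw [hZ0, hZ0] at this
    exact hab this
  have hc : ContinuousOn (fun s => (v s (Z b s) - v s (Z a s)) / (Z b s - Z a s)) (Ico 0 T) :=
    ((continuousOn_along hv.cont (hZ b).continuousOn).sub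
      (continuousOn_along hv.cont (hZ a).continuousOn)).div
      ((hZ b).continuousOn.sub (hZ a).continuousOn) fun s hs => sub_ne_zero.2 (hne s hs)
  refine ⟨hc, hne, ?_⟩
  have := eq_mul_exp_integral (y := fun s => Z b s - Z a s) hc (fun r hr =>
    ((hZ b r hr).sub (hZ a r hr)).congr_deriv
      (by rw [div_mul_cancel₀ _ (sub_ne_zero.2 (hne r hr))])) ht
  simpa [hZ0] using this

lemma flow_lipschitz (hv : IsSpeed T v) (hZ : ∀ b, IsCharacteristic v T (Z b))
    (hZ0 : ∀ b, Z b 0 = b) {t : ℝ} (ht : t ∈ Ico 0 T) :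
    ∃ C, ∀ s ∈ Icc 0 t, ∀ a b, |Z b s - Z a s| ≤ C * |b - a| := by
  obtain ⟨B, hB⟩ := hv.bdd t ht
  have hB0 : 0 ≤ B := (abs_nonneg _).trans (hB 0 ⟨le_rfl, ht.1⟩ 0).1
  refine ⟨Real.exp (B * t), fun s hs a b => ?_⟩
  have hsT : s < T := hs.2.trans_lt ht.2
  have := (abs_sub_le_of_abs_deriv_le (L := B) (A := fun _ => univ) hs.1
    (fun r hr => (hZ b).hasDerivWithinAt_Icc le_rfl hsT hr)
    (fun r hr => (hZ a).hasDerivWithinAt_Icc le_rfl hsT hr)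
    (fun r hr => hv.diff r ⟨hr.1, hr.2.trans_lt hsT⟩) (fun _ _ => convex_univ)
    (fun r hr x _ => (hB r ⟨hr.1, hr.2.trans hs.2⟩ x).2) (fun _ _ => mem_univ _)
    (fun _ _ => mem_univ _)).1
  rw [hZ0, hZ0, sub_zero] at this
  refine this.trans (mul_le_mul_of_nonneg_right (Real.exp_le_exp.2 ?_) (abs_nonneg _))
  exact mul_le_mul_of_nonneg_left hs.2 hB0

lemma flow_continuous (hv : IsSpeed T v) (hZ : ∀ b, IsCharacteristic v T (Z b))
    (hZ0 : ∀ b, Z b 0 = b) {t : ℝ} (ht : t ∈ Ico 0 T) : Continuous fun b => Z b t := by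
  obtain ⟨C, hC⟩ := flow_lipschitz hv hZ hZ0 ht
  refine continuous_iff_continuousAt.2 fun a => tendsto_iff_dist_tendsto_zero.2 ?_
  refine squeeze_zero (fun _ => dist_nonneg) (fun b => hC t ⟨ht.1, le_rfl⟩ a b) ?_
  have : Continuous fun b : ℝ => C * |b - a| := by fun_prop
  simpa using this.tendsto a

/-- The flow of a speed is differentiable in the initial point. -/
theorem hasDerivAt_flow (hv : IsSpeed T v) (hZ : ∀ b, IsCharacteristic v T (Z b))
    (hZ0 : ∀ b, Z b 0 = b) {t : ℝ} (ht : t ∈ Ico 0 T) (a : ℝ) :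
    HasDerivAt (fun b => Z b t) (Real.exp (∫ s in (0)..t, deriv (v s) (Z a s))) a := by
  obtain ⟨B, hB⟩ := hv.bdd t ht
  rw [hasDerivAt_iff_tendsto_slope]
  have hlim : Tendsto (fun b => ∫ s in (0)..t, (v s (Z b s) - v s (Z a s)) / (Z b s - Z a s))
      (𝓝[≠] a) (𝓝 (∫ s in (0)..t, deriv (v s) (Z a s))) := by
    refine intervalIntegral.tendsto_integral_filter_of_dominated_convergence (fun _ => B)
      ?_ ?_ intervalIntegrable_const ?_
    · filter_upwards [self_mem_nhdsWithin] with b hb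
      exact aestronglyMeasurable_of_continuousOn_Ico (flow_sub_eq hv hZ hZ0 ht hb).1 ht
    · filter_upwards [self_mem_nhdsWithin] with b hb
      refine Eventually.of_forall fun s hs => ?_
      obtain ⟨hs1, hs2⟩ := uIoc_subset_Ico ht hs
      have hne := (flow_sub_eq hv hZ hZ0 ht hb).2.1 s hs2
      rw [Real.norm_eq_abs, abs_div, div_le_iff₀ (abs_pos.2 (sub_ne_zero.2 hne))]
      exact abs_image_sub_le_of_abs_deriv_le convex_univ (hv.diff s hs2)
        (fun z _ => (hB s hs1 z).2) (mem_univ _) (mem_univ _)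
    · refine Eventually.of_forall fun s hs => ?_
      obtain ⟨hs1, hs2⟩ := uIoc_subset_Ico ht hs
      have h1 := (hv.diff s hs2 (Z a s)).hasDerivAt.tendsto_slope
      have h2 : Tendsto (fun b => Z b s) (𝓝[≠] a) (𝓝[≠] (Z a s)) := by
        refine tendsto_nhdsWithin_iff.2
          ⟨((flow_continuous hv hZ hZ0 hs2).tendsto a).mono_left nhdsWithin_le_nhds, ?_⟩
        filter_upwards [self_mem_nhdsWithin] with b hb
        exact (flow_sub_eq hv hZ hZ0 ht hb).2.1 s hs2
      refine (h1.comp h2).congr fun b => ?_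
      simp [slope_def_field]
  refine ((Real.continuous_exp.tendsto _).comp hlim).congr' ?_
  filter_upwards [self_mem_nhdsWithin] with b hb
  rw [slope_def_field, (flow_sub_eq hv hZ hZ0 ht hb).2.2, Function.comp]
  field_simp [sub_ne_zero.2 hb]

end Flow

lemma IsSpeed.exists_flow {T : ℝ} {v : ℝ → ℝ → ℝ} (hv : IsSpeed T v) (hT : 0 < T) :
    ∃ Z : ℝ → ℝ → ℝ, (∀ b, IsCharacteristic v T (Z b)) ∧ ∀ b, Z b 0 = b := by
  choose Z hZ using fun b => hv.exists_characteristic ⟨le_rfl, hT⟩ b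
  exact ⟨Z, fun b => (hZ b).1, fun b => (hZ b).2⟩

/-- A quantity transported along `v` can be differentiated in space when `v` and the source are
`C^1` in space, although the quantity has no second derivatives: its values on neighbouring
characteristics are differentiated with respect to the starting point. -/
theorem IsTransported.space_deriv {T : ℝ} {v w h : ℝ → ℝ → ℝ} (hv : IsSpeed T v)
    (hw : IsC1InSpace T w) (hh : IsC1InSpace T h) (htr : IsTransported T v w h) :
    IsTransported T v (fun t x => deriv (w t) x)
      (fun t x => deriv (h t) x - deriv (v t) x * deriv (w t) x) := by
  intro X hX t₀ ht₀
  have hT : 0 < T := ht₀.1.trans_lt ht₀.2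
  have h0 : (0 : ℝ) ∈ Ico 0 T := ⟨le_rfl, hT⟩
  obtain ⟨Z, hZ, hZ0⟩ := hv.exists_flow hT
  set a := X 0
  have hXZ : EqOn X (Z a) (Ico 0 T) := hv.eqOn hX (hZ a) h0 (by rw [hZ0])
  have hvx : ContinuousOn (fun s => deriv (v s) (Z a s)) (Ico 0 T) :=
    continuousOn_along (w := fun t x => deriv (v t) x) hv.cont_deriv (hZ a).continuousOn
  have hhx : ContinuousOn (fun s => deriv (h s) (Z a s)) (Ico 0 T) :=
    continuousOn_along (w := fun t x => deriv (h t) x) hh.cont_deriv (hZ a).continuousOn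
  set P : ℝ → ℝ := fun t => Real.exp (∫ s in (0)..t, deriv (v s) (Z a s)) with hP
  have hPd : ∀ t ∈ Ico 0 T, HasDerivWithinAt P (P t * deriv (v t) (Z a t)) (Ico 0 T) t :=
    fun t ht => (hasDerivWithinAt_primitive hvx ht).exp
  have hPc : ContinuousOn P (Ico 0 T) := fun t ht => (hPd t ht).continuousWithinAt
  have hc : ContinuousOn (fun s => deriv (h s) (Z a s) * P s) (Ico 0 T) := hhx.mul hPc
  -- the derivative with respect to the starting point of the transport relation
  have key : ∀ t ∈ Ico 0 T, deriv (w t) (Z a t) * P t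
      = deriv (w 0) a + ∫ s in (0)..t, deriv (h s) (Z a s) * P s := by
    intro t ht
    have hl : HasDerivAt (fun b => w t (Z b t)) (deriv (w t) (Z a t) * P t) a :=
      (hw.diff t ht (Z a t)).hasDerivAt.comp a (hasDerivAt_flow hv hZ hZ0 ht a)
    obtain ⟨C, hC⟩ := flow_lipschitz hv hZ hZ0 ht
    have hC0 : 0 ≤ C := by
      have := (abs_nonneg _).trans (hC 0 ⟨le_rfl, ht.1⟩ 0 1)
      simpa using this
    -- a compact neighbourhood of the characteristic, on which `h_x` is bounded
    have hZc : ContinuousOn (Z a) (Icc 0 t) :=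
      (hZ a).continuousOn.mono fun r hr => ⟨hr.1, hr.2.trans_lt ht.2⟩
    have hK : IsCompact ((fun p : ℝ × ℝ => (p.1, Z a p.1 + p.2)) '' (Icc 0 t ×ˢ Icc (-C) C)) := by
      refine (isCompact_Icc.prod isCompact_Icc).image_of_continuousOn ?_
      refine continuousOn_fst.prodMk (ContinuousOn.add ?_ continuousOn_snd)
      exact hZc.comp continuousOn_fst fun p hp => hp.1
    obtain ⟨H, hH⟩ := (hK.bddAbove_image (f := fun p : ℝ × ℝ => |deriv (h p.1) p.2|) (by
      refine (hh.cont_deriv.mono ?_).abs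
      rintro _ ⟨p, hp, rfl⟩
      simpa using ⟨hp.1.1, hp.1.2.trans_lt ht.2⟩))
    have hHb : ∀ s ∈ Icc 0 t, ∀ y ∈ Icc (Z a s - C) (Z a s + C), |deriv (h s) y| ≤ H := by
      intro s hs y hy
      refine hH ⟨(s, y), ⟨(s, y - Z a s), ⟨hs, by simpa using hy.1, by linarith [hy.2]⟩, ?_⟩, rfl⟩
      simp
    have hH0 : 0 ≤ H := (abs_nonneg _).trans
      (hHb 0 ⟨le_rfl, ht.1⟩ (Z a 0) ⟨by linarith, by linarith⟩)
    have hI := (intervalIntegral.hasDerivAt_integral_of_dominated_loc_of_lip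
      (μ := MeasureTheory.volume) (a := 0) (b := t)
      (F := fun b s => h s (Z b s)) (F' := fun s => deriv (h s) (Z a s) * P s) (x₀ := a)
      (s := Metric.closedBall a 1) (bound := fun _ => H * C)
      (Metric.closedBall_mem_nhds a one_pos)
      (Eventually.of_forall fun b => aestronglyMeasurable_of_continuousOn_Ico
        (continuousOn_along hh.cont (hZ b).continuousOn) ht)
      ((continuousOn_along hh.cont (hZ a).continuousOn).mono (by
        rw [uIcc_of_le ht.1]; exact fun r hr => ⟨hr.1, hr.2.trans_lt ht.2⟩)).intervalIntegrable
      (aestronglyMeasurable_of_continuousOn_Ico hc ht)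
      (Eventually.of_forall fun s hs => ?_) intervalIntegrable_const
      (Eventually.of_forall fun s hs => ?_)).2
    · have hr : HasDerivAt (fun b => w t (Z b t))
          (deriv (w 0) a + ∫ s in (0)..t, deriv (h s) (Z a s) * P s) a := by
        refine ((hw.diff 0 h0 a).hasDerivAt.add hI).congr_of_eventuallyEq ?_
        refine Eventually.of_forall fun b => ?_
        have := eq_add_integral (continuousOn_along hh.cont (hZ b).continuousOn)
          (fun r hr => htr (Z b) (hZ b) r hr) ht
        simpa [hZ0] using this
      exact hl.unique hr
    · obtain ⟨hs1, hs2⟩ := uIoc_subset_Ico ht hs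
      refine LipschitzOnWith.of_dist_le_mul fun b hb b' hb' => ?_
      have hmem : ∀ c ∈ Metric.closedBall a 1, Z c s ∈ Icc (Z a s - C) (Z a s + C) := by
        intro c hc
        rw [Metric.mem_closedBall, Real.dist_eq] at hc
        have h1 := hC s hs1 a c
        have h2 : C * |c - a| ≤ C := by nlinarith
        have := abs_le.1 (h1.trans h2)
        exact ⟨by linarith [this.1], by linarith [this.2]⟩
      have h1 := abs_image_sub_le_of_abs_deriv_le (convex_Icc _ _) (hh.diff s hs2) (hHb s hs1)
        (hmem b' hb') (hmem b hb)
      rw [Real.dist_eq, Real.dist_eq, Real.coe_nnabs, abs_of_nonneg (mul_nonneg hH0 hC0), mul_assoc]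
      exact h1.trans (mul_le_mul_of_nonneg_left (hC s hs1 b' b) hH0)
    · obtain ⟨hs1, hs2⟩ := uIoc_subset_Ico ht hs
      exact (hh.diff s hs2 (Z a s)).hasDerivAt.comp a (hasDerivAt_flow hv hZ hZ0 hs2 a)
  have hform : ∀ t ∈ Ico 0 T, deriv (w t) (X t)
      = (deriv (w 0) a + ∫ s in (0)..t, deriv (h s) (Z a s) * P s) / P t := by
    intro t ht
    rw [← key t ht, hXZ ht, mul_div_cancel_right₀ _ (Real.exp_pos _).ne']
  have hd := ((hasDerivWithinAt_primitive hc ht₀).const_add (deriv (w 0) a)).div (hPd t₀ ht₀)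
    (Real.exp_pos _).ne'
  refine (hd.congr_of_mem hform ht₀).congr_deriv ?_
  have hP0 : P t₀ ≠ 0 := (Real.exp_pos _).ne'
  rw [← key t₀ ht₀, hXZ ht₀]
  field_simp

/-! ### `C^1` functions on the strip and the maximum principle -/

lemma uniqueDiffOn_strip (T : ℝ) : UniqueDiffOn ℝ (strip T) :=
  (uniqueDiffOn_Ico 0 T).prod uniqueDiffOn_univ

section C1

variable {T : ℝ} {w : ℝ → ℝ → ℝ}

lemma IsC1On.hasFDerivWithinAt (hw : IsC1On (Ico 0 T) w) {t : ℝ} (ht : t ∈ Ico 0 T) (x : ℝ) :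
    HasFDerivWithinAt (fun p : ℝ × ℝ => w p.1 p.2)
      (fderivWithin ℝ (fun p : ℝ × ℝ => w p.1 p.2) (strip T) (t, x)) (strip T) (t, x) :=
  (hw.differentiableOn one_ne_zero (t, x) (by simpa using ht)).hasFDerivWithinAt

lemma IsC1On.hasDerivAt_space (hw : IsC1On (Ico 0 T) w) {t : ℝ} (ht : t ∈ Ico 0 T) (x : ℝ) :
    HasDerivAt (w t) (fderivWithin ℝ (fun p : ℝ × ℝ => w p.1 p.2) (strip T) (t, x) (0, 1)) x := by
  have h1 : HasDerivWithinAt (fun y : ℝ => (t, y)) ((0 : ℝ), (1 : ℝ)) univ x :=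
    ((hasDerivAt_const x t).prodMk (hasDerivAt_id x)).hasDerivWithinAt
  have := (hw.hasFDerivWithinAt ht x).comp_hasDerivWithinAt x h1 fun y _ => by simpa using ht
  exact this.hasDerivAt univ_mem

lemma IsC1On.isC1InSpace (hw : IsC1On (Ico 0 T) w) : IsC1InSpace T w where
  cont := hw.continuousOn
  diff t ht x := (hw.hasDerivAt_space ht x).differentiableAt
  cont_deriv := by
    have h1 : ContinuousOn (fun p => fderivWithin ℝ (fun p : ℝ × ℝ => w p.1 p.2) (strip T) p)
        (strip T) := hw.continuousOn_fderivWithin (uniqueDiffOn_strip T) le_rfl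
    refine (h1.clm_apply (continuousOn_const (c := ((0 : ℝ), (1 : ℝ))))).congr fun p hp => ?_
    exact (hw.hasDerivAt_space (mem_strip.1 hp) p.2).deriv

lemma IsC1On.hasDerivAt_time (hw : IsC1On (Ico 0 T) w) {t : ℝ} (ht : t ∈ Ioo 0 T) (x : ℝ) :
    HasDerivAt (fun s => w s x)
      (fderivWithin ℝ (fun p : ℝ × ℝ => w p.1 p.2) (strip T) (t, x) (1, 0)) t := by
  have h1 : HasDerivWithinAt (fun s : ℝ => (s, x)) ((1 : ℝ), (0 : ℝ)) (Ico 0 T) t :=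
    ((hasDerivAt_id t).prodMk (hasDerivAt_const t x)).hasDerivWithinAt
  have := (hw.hasFDerivWithinAt (Ioo_subset_Ico_self ht) x).comp_hasDerivWithinAt t h1
    fun y hy => by simpa using hy
  exact this.hasDerivAt (Ico_mem_nhds ht.1 ht.2)

lemma strip_subset_closure (T : ℝ) : strip T ⊆ closure (Ioo 0 T ×ˢ univ : Set (ℝ × ℝ)) := by
  rintro ⟨t, x⟩ h
  have ht := mem_strip.1 h
  rw [closure_prod_eq, closure_Ioo (ht.1.trans_lt ht.2).ne]
  exact ⟨Ico_subset_Icc_self ht, subset_closure (mem_univ _)⟩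

/-- A `C^1` solution of `w_t + v w_x = h` satisfies the equation along characteristics, the
initial time included. -/
lemma IsC1On.isTransported (hw : IsC1On (Ico 0 T) w) {v h : ℝ → ℝ → ℝ}
    (hv : ContinuousOn (fun p : ℝ × ℝ => v p.1 p.2) (strip T))
    (hh : ContinuousOn (fun p : ℝ × ℝ => h p.1 p.2) (strip T))
    (heq : ∀ t ∈ Ioo 0 T, ∀ x, deriv (fun s => w s x) t + v t x * deriv (w t) x = h t x) :
    IsTransported T v w h := by
  have h1 : ContinuousOn (fun p => fderivWithin ℝ (fun p : ℝ × ℝ => w p.1 p.2) (strip T) p)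
      (strip T) := hw.continuousOn_fderivWithin (uniqueDiffOn_strip T) le_rfl
  have key : EqOn (fun p : ℝ × ℝ => fderivWithin ℝ (fun p : ℝ × ℝ => w p.1 p.2) (strip T) p (1, 0)
      + v p.1 p.2 * fderivWithin ℝ (fun p : ℝ × ℝ => w p.1 p.2) (strip T) p (0, 1))
      (fun p => h p.1 p.2) (strip T) := by
    refine EqOn.of_subset_closure (s := Ioo 0 T ×ˢ univ) ?_
      ((h1.clm_apply (continuousOn_const (c := ((1 : ℝ), (0 : ℝ))))).add
        (hv.mul (h1.clm_apply (continuousOn_const (c := ((0 : ℝ), (1 : ℝ))))))) hh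
      (prod_mono Ioo_subset_Ico_self subset_rfl) (strip_subset_closure T)
    rintro ⟨t, x⟩ ⟨ht, -⟩
    have ht' : t ∈ Ico 0 T := Ioo_subset_Ico_self ht
    have := heq t ht x
    rw [(hw.hasDerivAt_time ht x).deriv, (hw.hasDerivAt_space ht' x).deriv] at this
    exact this
  intro Z hZ t ht
  have hZ1 : HasDerivWithinAt (fun s => (s, Z s)) ((1 : ℝ), v t (Z t)) (Ico 0 T) t :=
    (hasDerivAt_id t).hasDerivWithinAt.prodMk (hZ t ht)
  have h2 := (hw.hasFDerivWithinAt ht (Z t)).comp_hasDerivWithinAt t hZ1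
    fun s hs => by simpa using hs
  refine h2.congr_deriv ?_
  have h3 := key (x := (t, Z t)) (by simpa using ht)
  simp only at h3
  rw [← h3]
  have h4 : ((1 : ℝ), v t (Z t)) = (1, 0) + v t (Z t) • ((0 : ℝ), (1 : ℝ)) := by simp
  rw [h4, map_add, map_smul, smul_eq_mul]

end C1

lemma IsTransported.add {T : ℝ} {v w h w' h' : ℝ → ℝ → ℝ} (hw : IsTransported T v w h)
    (hw' : IsTransported T v w' h') :
    IsTransported T v (fun t x => w t x + w' t x) (fun t x => h t x + h' t x) :=
  fun Z hZ t ht => (hw Z hZ t ht).add (hw' Z hZ t ht)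

lemma IsTransported.sub_const {T : ℝ} {v w h : ℝ → ℝ → ℝ} (hw : IsTransported T v w h) (c : ℝ) :
    IsTransported T v (fun t x => w t x - c) h :=
  fun Z hZ t ht => (hw Z hZ t ht).sub_const c

lemma IsTransported.const_mul {T : ℝ} {v w h : ℝ → ℝ → ℝ} (hw : IsTransported T v w h) (c : ℝ) :
    IsTransported T v (fun t x => c * w t x) (fun t x => c * h t x) :=
  fun Z hZ t ht => (hw Z hZ t ht).const_mul c

lemma IsTransported.congr {T : ℝ} {v w h h' : ℝ → ℝ → ℝ} (hw : IsTransported T v w h)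
    (hh : ∀ t ∈ Ico 0 T, ∀ x, h t x = h' t x) : IsTransported T v w h' :=
  fun Z hZ t ht => (hw Z hZ t ht).congr_deriv (hh t ht _)

section MaxPrinciple

/-- The points of `[0, τ] × ℝ` from which nothing that moves with speed at most `V` leaves the
interval `[c - R, c + R]` by the time `τ`. -/
def cone (c R V τ : ℝ) : Set (ℝ × ℝ) := {p | p.1 ∈ Icc 0 τ ∧ |p.2 - c| ≤ R + V * (τ - p.1)}

lemma isCompact_cone {c R V τ : ℝ} (hV : 0 ≤ V) : IsCompact (cone c R V τ) := by
  refine (isCompact_Icc (a := (0, c - (R + V * τ))) (b := (τ, c + (R + V * τ)))).of_isClosed_subset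
    ?_ ?_
  · exact (isClosed_Icc.preimage continuous_fst).inter
      (isClosed_le (f := fun p : ℝ × ℝ => |p.2 - c|) (g := fun p => R + V * (τ - p.1))
        (by fun_prop) (by fun_prop))
  · rintro ⟨t, x⟩ ⟨⟨h1, h2⟩, h3⟩
    have h4 : V * (τ - t) ≤ V * τ := mul_le_mul_of_nonneg_left (by simp at h1; linarith) hV
    have h5 := abs_le.1 h3
    simp only at h1 h2 h5
    exact ⟨⟨h1, by simp only; linarith⟩, ⟨h2, by simp only; linarith⟩⟩

lemma IsCharacteristic.abs_sub_le_mul {v : ℝ → ℝ → ℝ} {T V s t : ℝ} {Z : ℝ → ℝ}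
    (hZ : IsCharacteristic v T Z) (hs : 0 ≤ s) (hst : s ≤ t) (ht : t < T)
    (hV : ∀ r ∈ Icc s t, |v r (Z r)| ≤ V) : |Z t - Z s| ≤ V * (t - s) := by
  have := (convex_Icc s t).norm_image_sub_le_of_norm_hasDerivWithin_le
    (fun r hr => hZ.hasDerivWithinAt_Icc hs ht hr) (by simpa using hV) (left_mem_Icc.2 hst)
    (right_mem_Icc.2 hst)
  simpa [Real.norm_eq_abs, abs_of_nonneg (sub_nonneg.2 hst)] using this

lemma IsCharacteristic.mem_cone {v : ℝ → ℝ → ℝ} {T c R V τ s t : ℝ} {Z : ℝ → ℝ}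
    (hZ : IsCharacteristic v T Z) (hV : ∀ r ∈ Icc 0 τ, ∀ x, |v r x| ≤ V)
    (ht : (t, Z t) ∈ cone c R V τ) (htT : t < T) (hs : s ∈ Icc 0 t) :
    (s, Z s) ∈ cone c R V τ := by
  obtain ⟨⟨h1, h2⟩, h3⟩ := ht
  simp only at h1 h2 h3
  refine ⟨⟨hs.1, hs.2.trans h2⟩, ?_⟩
  have h4 := hZ.abs_sub_le_mul hs.1 hs.2 htT fun r hr => hV r ⟨hs.1.trans hr.1, hr.2.trans h2⟩ _
  have h5 : |Z s - c| ≤ |Z t - Z s| + |Z t - c| := by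
    have := abs_sub_le (Z s) (Z t) c
    rwa [abs_sub_comm (Z s) (Z t)] at this
  simp only
  nlinarith

/-- If `exp (-(lam * s)) * y s` is largest at the right end point, then `lam * y ≤ y'` there. -/
lemma mul_le_of_weighted_max {y : ℝ → ℝ} {d lam t₁ : ℝ} (ht : 0 < t₁)
    (hy : HasDerivWithinAt y d (Icc 0 t₁) t₁)
    (hmax : ∀ s ∈ Icc 0 t₁, Real.exp (-(lam * s)) * y s ≤ Real.exp (-(lam * t₁)) * y t₁) :
    lam * y t₁ ≤ d := by
  have h1 : HasDerivWithinAt (fun s : ℝ => Real.exp (-(lam * s)))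
      (Real.exp (-(lam * t₁)) * (-(lam * 1))) (Icc 0 t₁) t₁ :=
    (((hasDerivAt_id t₁).const_mul lam).neg.exp).hasDerivWithinAt
  have h2 := h1.mul hy
  have h3 := (hasDerivWithinAt_iff_tendsto_slope' (by simp)).1 (h2.mono Ico_subset_Icc_self)
  have hne : (𝓝[Ico 0 t₁] t₁).NeBot := by
    rw [← mem_closure_iff_nhdsWithin_neBot, closure_Ico ht.ne]
    exact right_mem_Icc.2 ht.le
  have h4 := ge_of_tendsto h3 (b := 0) (by
    filter_upwards [self_mem_nhdsWithin] with s hs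
    rw [slope_def_field]
    refine div_nonneg_of_nonpos ?_ (sub_nonpos.2 hs.2.le)
    simpa using hmax s (Ico_subset_Icc_self hs))
  have h5 := Real.exp_pos (-(lam * t₁))
  by_contra! hcon
  nlinarith

/-- Maximum principle for finitely many quantities, each transported along its own velocity field:
if at the points where one of them is the largest and exceeds `C`, its source is below `lam` times
its value, then they grow at most by the factor `exp (lam * t)`. -/
theorem le_of_transported_of_source_lt {ι : Type*} [Finite ι] [Nonempty ι] {T c R V τ lam C : ℝ}
    {v w h : ι → ℝ → ℝ → ℝ} (hv : ∀ i, IsSpeed T (v i)) (hτ : τ ∈ Ico 0 T) (hV0 : 0 ≤ V)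
    (hV : ∀ i, ∀ t ∈ Icc 0 τ, ∀ x, |v i t x| ≤ V) (hlam : 0 ≤ lam) (hC : 0 ≤ C)
    (hw : ∀ i, ContinuousOn (fun p : ℝ × ℝ => w i p.1 p.2) (strip T))
    (htr : ∀ i, IsTransported T (v i) (w i) (h i)) (h0 : ∀ i x, w i 0 x ≤ C)
    (hsrc : ∀ i t x, (t, x) ∈ cone c R V τ → (∀ j, w j t x ≤ w i t x) → C < w i t x →
      h i t x < lam * w i t x)
    {t x : ℝ} (htx : (t, x) ∈ cone c R V τ) (i : ι) : w i t x ≤ C * Real.exp (lam * t) := by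
  have hsub : cone c R V τ ⊆ strip T := fun p hp => by
    simpa using ⟨hp.1.1, hp.1.2.trans_lt hτ.2⟩
  -- the largest value of `exp (-(lam * t)) * w i t x` over `i` and over the cone is attained
  have hmax : ∀ i, ∃ p ∈ cone c R V τ, IsMaxOn
      (fun p : ℝ × ℝ => Real.exp (-(lam * p.1)) * w i p.1 p.2) (cone c R V τ) p := fun i =>
    (isCompact_cone hV0).exists_isMaxOn ⟨_, htx⟩
      ((by fun_prop : Continuous fun p : ℝ × ℝ => Real.exp (-(lam * p.1))).continuousOn.mul
        ((hw i).mono hsub))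
  choose p hp hpmax using hmax
  obtain ⟨k, hk⟩ := Finite.exists_max fun i => Real.exp (-(lam * (p i).1)) * w i (p i).1 (p i).2
  obtain ⟨t₁, x₁, hpk⟩ : ∃ t₁ x₁, p k = (t₁, x₁) := ⟨_, _, rfl⟩
  have hpk1 := hp k
  have hbound : ∀ j s y, (s, y) ∈ cone c R V τ →
      Real.exp (-(lam * s)) * w j s y ≤ Real.exp (-(lam * t₁)) * w k t₁ x₁ := by
    intro j s y hsy
    have h1 := hpmax j hsy
    have h2 := hk j
    rw [hpk] at h2
    exact h1.trans h2
  rw [hpk] at hpk1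
  have hexp : ∀ s : ℝ, Real.exp (-(lam * s)) * Real.exp (lam * s) = 1 := fun s => by
    rw [← Real.exp_add]; simp
  suffices hle : Real.exp (-(lam * t₁)) * w k t₁ x₁ ≤ C by
    have h1 := mul_le_mul_of_nonneg_right ((hbound i t x htx).trans hle) (Real.exp_pos (lam * t)).le
    rwa [mul_right_comm, hexp, one_mul] at h1
  by_contra! hlt
  have ht1 : t₁ ∈ Ico 0 T := mem_strip.1 (hsub hpk1)
  have hpos : 0 < t₁ := by
    refine lt_of_le_of_ne ht1.1 fun h => ?_
    have := h0 k x₁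
    rw [← h] at hlt
    simp at hlt
    linarith
  have hle1 : Real.exp (-(lam * t₁)) ≤ 1 := by
    rw [Real.exp_le_one_iff]; have := mul_nonneg hlam ht1.1; linarith
  have hw1 : C < w k t₁ x₁ := by
    by_contra! hcon
    have := mul_le_mul_of_nonneg_left hcon (Real.exp_pos (-(lam * t₁))).le
    nlinarith
  -- the characteristic that arrives at the maximum stays in the cone
  obtain ⟨Z, hZ, hZ1⟩ := (hv k).exists_characteristic ht1 x₁
  have hd := (htr k Z hZ t₁ ht1).mono (s := Icc 0 t₁) fun r hr => ⟨hr.1, hr.2.trans_lt ht1.2⟩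
  have hcon := mul_le_of_weighted_max hpos hd fun s hs => by
    rw [hZ1]
    exact hbound k s (Z s) (hZ.mem_cone (hV k) (by rwa [hZ1]) ht1.2 hs)
  rw [hZ1] at hcon
  refine (hsrc k t₁ x₁ hpk1 (fun j => ?_) hw1).not_ge hcon
  exact le_of_mul_le_mul_left (hbound j t₁ x₁ hpk1) (Real.exp_pos _)

end MaxPrinciple

/-! ### The equations of `ρ`, `u` and `e`, and their a priori bounds -/

section Solution

variable {f : ℝ → ℝ} {T : ℝ} {ρ u : ℝ → ℝ → ℝ}

lemma IsC1Solution.isSpeed_u (hs : IsC1Solution f (Ico 0 T) ρ u)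
    (hb : IsLocallyBoundedC1 (Ico 0 T) ρ u) : IsSpeed T u where
  toIsC1InSpace := hs.c1_u.isC1InSpace
  bdd τ hτ := (hb τ hτ).imp fun _ hB t ht x => ⟨(hB t ht x).2.1, (hB t ht x).2.2.2⟩

lemma exists_abs_le_of_continuous {g : ℝ → ℝ} (hg : Continuous g) (B : ℝ) :
    ∃ C, 0 ≤ C ∧ ∀ y, |y| ≤ B → |g y| ≤ C := by
  obtain ⟨C, hC⟩ := isCompact_Icc.exists_bound_of_continuousOn (s := Icc (-B) B) hg.continuousOn
  exact ⟨max C 0, le_max_right _ _, fun y hy => (hC y (abs_le.1 hy)).trans (le_max_left _ _)⟩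

lemma IsC1InSpace.comp {w : ℝ → ℝ → ℝ} {g : ℝ → ℝ} (hg : ContDiff ℝ 1 g)
    (hw : IsC1InSpace T w) : IsC1InSpace T (fun t x => g (w t x)) where
  cont := hg.continuous.comp_continuousOn hw.cont
  diff t ht := (hg.differentiable one_ne_zero).comp (hw.diff t ht)
  cont_deriv := by
    refine (((hg.continuous_deriv le_rfl).comp_continuousOn hw.cont).mul hw.cont_deriv).congr
      fun p hp => ?_
    exact ((hg.differentiable one_ne_zero _).hasDerivAt.comp p.2
      (hw.diff p.1 (mem_strip.1 hp) p.2).hasDerivAt).deriv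

lemma IsC1InSpace.mul {w w' : ℝ → ℝ → ℝ} (hw : IsC1InSpace T w) (hw' : IsC1InSpace T w') :
    IsC1InSpace T (fun t x => w t x * w' t x) where
  cont := hw.cont.mul hw'.cont
  diff t ht := (hw.diff t ht).mul (hw'.diff t ht)
  cont_deriv := ((hw.cont_deriv.mul hw'.cont).add (hw.cont.mul hw'.cont_deriv)).congr fun _ hp =>
    deriv_mul (hw.diff _ (mem_strip.1 hp) _) (hw'.diff _ (mem_strip.1 hp) _)

lemma IsC1InSpace.sub {w w' : ℝ → ℝ → ℝ} (hw : IsC1InSpace T w) (hw' : IsC1InSpace T w') :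
    IsC1InSpace T (fun t x => w t x - w' t x) where
  cont := hw.cont.sub hw'.cont
  diff t ht := (hw.diff t ht).sub (hw'.diff t ht)
  cont_deriv := (hw.cont_deriv.sub hw'.cont_deriv).congr fun _ hp =>
    deriv_sub (hw.diff _ (mem_strip.1 hp) _) (hw'.diff _ (mem_strip.1 hp) _)

lemma IsC1InSpace.hasDerivAt {w : ℝ → ℝ → ℝ} (hw : IsC1InSpace T w) {t : ℝ} (ht : t ∈ Ico 0 T)
    (x : ℝ) : HasDerivAt (w t) (deriv (w t) x) x :=
  (hw.diff t ht x).hasDerivAt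

lemma hasDerivAt_comp_contDiff {g : ℝ → ℝ} (hg : ContDiff ℝ 1 g) {y : ℝ → ℝ} {y' x : ℝ}
    (hy : HasDerivAt y y' x) : HasDerivAt (fun x => g (y x)) (deriv g (y x) * y') x :=
  (hg.differentiable one_ne_zero _).hasDerivAt.comp x hy

variable (hf : ContDiff ℝ ∞ f) (hs : IsC1Solution f (Ico 0 T) ρ u)
  (hb : IsLocallyBoundedC1 (Ico 0 T) ρ u)

include hf in
lemma contDiff_deriv_of_smooth : ContDiff ℝ ∞ (deriv f) := (contDiff_infty_iff_deriv.1 hf).2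

include hf hs hb in
lemma IsC1Solution.isSpeed_fu : IsSpeed T (fun t x => f (u t x)) where
  toIsC1InSpace := hs.c1_u.isC1InSpace.comp (hf.of_le (by norm_cast))
  bdd τ hτ := by
    obtain ⟨B, hB⟩ := (hs.isSpeed_u hb).bdd τ hτ
    obtain ⟨C, hC0, hC⟩ := exists_abs_le_of_continuous hf.continuous B
    obtain ⟨D, hD0, hD⟩ := exists_abs_le_of_continuous (contDiff_deriv_of_smooth hf).continuous B
    refine ⟨max C (D * B), fun t ht x => ⟨(hC _ (hB t ht x).1).trans (le_max_left _ _), ?_⟩⟩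
    have htT : t ∈ Ico 0 T := ⟨ht.1, ht.2.trans_lt hτ.2⟩
    rw [(hasDerivAt_comp_contDiff (hf.of_le (by norm_cast))
      (hs.c1_u.isC1InSpace.hasDerivAt htT x)).deriv, abs_mul]
    exact (mul_le_mul (hD _ (hB t ht x).1) (hB t ht x).2 (abs_nonneg _) hD0).trans
      (le_max_right _ _)

include hs in
lemma IsC1Solution.continuousOn_e :
    ContinuousOn (fun p : ℝ × ℝ => eField ρ u p.1 p.2) (strip T) :=
  hs.c1_u.isC1InSpace.cont_deriv.add hs.c1_rho.isC1InSpace.cont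

include hf hs in
/-- The derivative of the flux `ρ f(u)`. -/
lemma IsC1Solution.deriv_flux {t : ℝ} (ht : t ∈ Ico 0 T) (x : ℝ) :
    deriv (fun y => ρ t y * f (u t y)) x
      = deriv (ρ t) x * f (u t x) + ρ t x * (deriv f (u t x) * deriv (u t) x) :=
  ((hs.c1_rho.isC1InSpace.hasDerivAt ht x).mul (hasDerivAt_comp_contDiff
    (hf.of_le (by norm_cast)) (hs.c1_u.isC1InSpace.hasDerivAt ht x))).deriv

include hf hs in
lemma IsC1Solution.transport_rho :
    IsTransported T (fun t x => f (u t x)) ρ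
      (fun t x => deriv f (u t x) * (ρ t x - eField ρ u t x) * ρ t x) := by
  have hu := hs.c1_u.isC1InSpace
  refine hs.c1_rho.isTransported (hf.continuous.comp_continuousOn hu.cont)
    ((((contDiff_deriv_of_smooth hf).continuous.comp_continuousOn hu.cont).mul
      (hs.c1_rho.isC1InSpace.cont.sub hs.continuousOn_e)).mul hs.c1_rho.isC1InSpace.cont)
    fun t ht x => ?_
  have := hs.mass t (by rwa [interior_Ico]) x
  rw [hs.deriv_flux hf (Ioo_subset_Ico_self ht)] at this
  simp only [eField]
  linear_combination this

include hf hs in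
lemma IsC1Solution.transport_u :
    IsTransported T u u (fun t x => ρ t x * (f (u t x) - u t x)) := by
  have hu := hs.c1_u.isC1InSpace
  refine hs.c1_u.isTransported hu.cont (hs.c1_rho.isC1InSpace.cont.mul
    ((hf.continuous.comp_continuousOn hu.cont).sub hu.cont)) fun t ht x => ?_
  exact hs.velocity t (by rwa [interior_Ico]) x

include hf hs hb in
/-- `e_t + (u e)_x = 0`, that is `e' = e (ρ - e)` along the characteristics of `u`, for solutions
that are only `C^1`. -/
theorem IsC1Solution.transport_e :
    IsTransported T u (eField ρ u) (fun t x => (ρ t x - eField ρ u t x) * eField ρ u t x) := by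
  have hf1 : ContDiff ℝ 1 f := hf.of_le (by norm_cast)
  have hu := hs.c1_u.isC1InSpace
  have hr := hs.c1_rho.isC1InSpace
  have hsrc : IsC1InSpace T (fun t x => ρ t x * (f (u t x) - u t x)) := hr.mul ((hu.comp hf1).sub hu)
  have h1 := (hs.transport_u hf).space_deriv (hs.isSpeed_u hb) hu hsrc
  have h2 : IsTransported T u ρ (fun t x => u t x * deriv (ρ t) x
      - (deriv (ρ t) x * f (u t x) + ρ t x * (deriv f (u t x) * deriv (u t) x))) := by
    refine hs.c1_rho.isTransported hu.cont ((hu.cont.mul hr.cont_deriv).sub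
      ((hr.cont_deriv.mul (hf.continuous.comp_continuousOn hu.cont)).add (hr.cont.mul
        (((contDiff_deriv_of_smooth hf).continuous.comp_continuousOn hu.cont).mul
          hu.cont_deriv)))) fun t ht x => ?_
    have := hs.mass t (by rwa [interior_Ico]) x
    rw [hs.deriv_flux hf (Ioo_subset_Ico_self ht)] at this
    linear_combination this
  -- in the sum of the two sources, the terms with `ρ_x` and with `f'(u)` cancel
  refine (h1.add h2).congr fun t ht x => ?_
  have h3 : deriv (fun x => ρ t x * (f (u t x) - u t x)) x = deriv (ρ t) x * (f (u t x) - u t x)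
      + ρ t x * (deriv f (u t x) * deriv (u t) x - deriv (u t) x) :=
    ((hr.hasDerivAt ht x).mul ((hasDerivAt_comp_contDiff hf1 (hu.hasDerivAt ht x)).sub
      (hu.hasDerivAt ht x))).deriv
  rw [h3, eField]
  ring

include hf hs hb in
lemma IsC1Solution.rho_nonneg (h0 : ∀ x, 0 ≤ ρ 0 x) {t : ℝ} (ht : t ∈ Ico 0 T) (x : ℝ) :
    0 ≤ ρ t x := by
  obtain ⟨Y, hY, rfl⟩ := (hs.isSpeed_fu hf hb).exists_characteristic ht x
  have hu := hs.c1_u.isC1InSpace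
  have hc : ContinuousOn (fun t => deriv f (u t (Y t)) * (ρ t (Y t) - eField ρ u t (Y t)))
      (Ico 0 T) :=
    ((contDiff_deriv_of_smooth hf).continuous.comp_continuousOn
      (continuousOn_along hu.cont hY.continuousOn)).mul
      ((continuousOn_along hs.c1_rho.isC1InSpace.cont hY.continuousOn).sub
        (continuousOn_along hs.continuousOn_e hY.continuousOn))
  rw [eq_mul_exp_integral (y := fun s => ρ s (Y s)) hc (fun r hr => hs.transport_rho hf Y hY r hr)
    ht]
  exact mul_nonneg (h0 _) (Real.exp_pos _).le

/-- The factor by which the flow of `u` stretches space along the curve `X`. -/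
noncomputable def stretch (u : ℝ → ℝ → ℝ) (X : ℝ → ℝ) (t : ℝ) : ℝ :=
  Real.exp (∫ s in (0)..t, deriv (u s) (X s))

lemma stretch_pos (u : ℝ → ℝ → ℝ) (X : ℝ → ℝ) (t : ℝ) : 0 < stretch u X t := Real.exp_pos _

lemma stretch_zero (u : ℝ → ℝ → ℝ) (X : ℝ → ℝ) : stretch u X 0 = 1 := by simp [stretch]

include hf hs hb in
/-- Conservation of `e dx` along the flow of `u`. -/
lemma IsC1Solution.e_mul_stretch {X : ℝ → ℝ} (hX : IsCharacteristic u T X) {t : ℝ}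
    (ht : t ∈ Ico 0 T) : eField ρ u t (X t) * stretch u X t = eField ρ u 0 (X 0) := by
  have hc : ContinuousOn (fun s => deriv (u s) (X s)) (Ico 0 T) :=
    continuousOn_along (w := fun t x => deriv (u t) x) hs.c1_u.isC1InSpace.cont_deriv
      hX.continuousOn
  have := eq_of_hasDerivWithinAt_zero (y := fun t => eField ρ u t (X t) * stretch u X t)
    (fun r hr => ((hs.transport_e hf hb X hX r hr).mul
      (hasDerivWithinAt_primitive hc hr).exp).congr_deriv (by
        simp only [eField]; ring)) ht
  rw [this, stretch_zero, mul_one]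

include hf hs hb in
/-- The stretching solves the linear equation `P' = e₀ - ρ P`, which does not degenerate where `e`
blows up. -/
lemma IsC1Solution.hasDerivWithinAt_stretch {X : ℝ → ℝ} (hX : IsCharacteristic u T X) {t : ℝ}
    (ht : t ∈ Ico 0 T) : HasDerivWithinAt (stretch u X)
      (eField ρ u 0 (X 0) - ρ t (X t) * stretch u X t) (Ico 0 T) t := by
  have hc : ContinuousOn (fun s => deriv (u s) (X s)) (Ico 0 T) :=
    continuousOn_along (w := fun t x => deriv (u t) x) hs.c1_u.isC1InSpace.cont_deriv
      hX.continuousOn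
  refine (hasDerivWithinAt_primitive hc ht).exp.congr_deriv ?_
  rw [← hs.e_mul_stretch hf hb hX ht]
  simp only [eField, stretch]
  ring

variable (hfu : ∀ t ∈ Ico 0 T, ∀ x, deriv f (u t x) ≤ 0)

include hf hs hb hfu in
/-- The maximum principle for the pair `(ρ, e)`. -/
theorem IsC1Solution.le_of_initial_le (h0 : ∀ x, 0 ≤ ρ 0 x) {M : ℝ} (hM : 0 ≤ M)
    (hM0 : ∀ x, ρ 0 x ≤ M ∧ eField ρ u 0 x ≤ M) {t : ℝ} (ht : t ∈ Ico 0 T) (x : ℝ) :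
    ρ t x ≤ M ∧ eField ρ u t x ≤ M := by
  obtain ⟨B, hB⟩ := (hs.isSpeed_u hb).bdd t ht
  obtain ⟨B', hB'⟩ := (hs.isSpeed_fu hf hb).bdd t ht
  have hB0 : 0 ≤ B := (abs_nonneg _).trans (hB 0 ⟨le_rfl, ht.1⟩ 0).1
  -- any `lam > 0` serves: the sources of `ρ - M` and `e - M` are nonpositive where the maximum
  -- principle needs them below `lam` times a positive value
  have key := fun i => le_of_transported_of_source_lt (ι := Bool) (c := x) (R := 0)
    (V := max B B') (τ := t) (lam := 1) (C := 0)
    (v := fun i => cond i (fun t x => f (u t x)) u)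
    (w := fun i t x => cond i ρ (eField ρ u) t x - M)
    (h := fun i => cond i (fun t x => deriv f (u t x) * (ρ t x - eField ρ u t x) * ρ t x)
      (fun t x => (ρ t x - eField ρ u t x) * eField ρ u t x))
    (Bool.rec (hs.isSpeed_u hb) (hs.isSpeed_fu hf hb)) ht (hB0.trans (le_max_left _ _))
    (Bool.rec (fun s hs x => (hB s hs x).1.trans (le_max_left _ _))
      (fun s hs x => (hB' s hs x).1.trans (le_max_right _ _))) zero_le_one le_rfl
    (Bool.rec (hs.continuousOn_e.sub continuousOn_const)
      (hs.c1_rho.continuousOn.sub continuousOn_const))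
    (Bool.rec ((hs.transport_e hf hb).sub_const M) ((hs.transport_rho hf).sub_const M))
    (Bool.rec (fun x => sub_nonpos.2 (hM0 x).2) (fun x => sub_nonpos.2 (hM0 x).1))
    ?_ (t := t) (x := x) ⟨⟨ht.1, le_rfl⟩, by simp⟩ i
  · have h1 := key true
    have h2 := key false
    simp only [zero_mul, cond_true, cond_false, sub_nonpos] at h1 h2
    exact ⟨h1, h2⟩
  · intro i s y hsy hj hpos
    have hsT : s ∈ Ico 0 T := ⟨hsy.1.1, hsy.1.2.trans_lt ht.2⟩
    have hr := hs.rho_nonneg hf hb h0 hsT y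
    cases i
    · have := hj true
      simp only [cond_true, cond_false] at this hpos ⊢
      nlinarith
    · have := hj false
      simp only [cond_true, cond_false] at this hpos ⊢
      have h1 : 0 ≤ (ρ s y - eField ρ u s y) * ρ s y := mul_nonneg (by linarith) hr
      nlinarith [hfu s hsT y]

include hf hs hb in
lemma IsC1Solution.e_nonneg (h0 : ∀ x, 0 ≤ eField ρ u 0 x) {t : ℝ} (ht : t ∈ Ico 0 T) (x : ℝ) :
    0 ≤ eField ρ u t x := by
  obtain ⟨X, hX, rfl⟩ := (hs.isSpeed_u hb).exists_characteristic ht x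
  have := hs.e_mul_stretch hf hb hX ht
  by_contra! h
  have h1 := mul_neg_of_neg_of_pos h (stretch_pos u X t)
  linarith [h0 (X 0)]

include hf hs hb in
lemma IsC1Solution.stretch_le (h0 : ∀ x, 0 ≤ ρ 0 x) {X : ℝ → ℝ} (hX : IsCharacteristic u T X)
    {t : ℝ} (ht : t ∈ Ico 0 T) : stretch u X t ≤ 1 + eField ρ u 0 (X 0) * t := by
  have hanti : AntitoneOn (fun s => stretch u X s - eField ρ u 0 (X 0) * s) (Icc 0 t) := by
    have hd : ∀ r ∈ Icc 0 t, HasDerivWithinAt (fun s => stretch u X s - eField ρ u 0 (X 0) * s)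
        (eField ρ u 0 (X 0) - ρ r (X r) * stretch u X r - eField ρ u 0 (X 0) * 1) (Icc 0 t) r :=
      fun r hr => (((hs.hasDerivWithinAt_stretch hf hb hX ⟨hr.1, hr.2.trans_lt ht.2⟩).sub
        ((hasDerivAt_id r).const_mul _).hasDerivWithinAt)).mono
          fun q hq => ⟨hq.1, hq.2.trans_lt ht.2⟩
    refine antitoneOn_of_hasDerivWithinAt_nonpos (convex_Icc 0 t)
      (fun r hr => (hd r hr).continuousWithinAt)
      (fun r hr => (hd r (interior_subset hr)).mono interior_subset) fun r hr => ?_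
    have hr' := interior_subset hr
    have := mul_nonneg (hs.rho_nonneg hf hb h0 ⟨hr'.1, hr'.2.trans_lt ht.2⟩ (X r))
      (stretch_pos u X r).le
    linarith
  have h1 := hanti ⟨le_rfl, ht.1⟩ ⟨ht.1, le_rfl⟩ ht.1
  simp only [stretch_zero, mul_zero, sub_zero] at h1
  linarith

include hf hs hb in
/-- Where `e₀ < 0`, the stretching cannot remain positive up to the time `-1 / e₀`. -/
lemma IsC1Solution.lifespan_le (h0 : ∀ x, 0 ≤ ρ 0 x) (hT : 0 < T) {x : ℝ}
    (hx : eField ρ u 0 x < 0) : T ≤ -1 / eField ρ u 0 x := by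
  obtain ⟨X, hX, rfl⟩ := (hs.isSpeed_u hb).exists_characteristic (t₁ := 0) ⟨le_rfl, hT⟩ x
  refine le_of_forall_lt fun t htT => ?_
  rcases lt_or_ge t 0 with ht0 | ht0
  · exact ht0.trans (div_pos_of_neg_of_neg (by norm_num) hx)
  rw [lt_div_iff_of_neg hx]
  linarith [stretch_pos u X t, hs.stretch_le hf hb h0 hX ⟨ht0, htT⟩]

include hf hs hb hfu in
/-- Since `f` decreases on the interval of the values of `u`, the source `ρ (f(u) - u)` pushes `u`
back towards any fixed value, up to a bounded amount. -/
lemma IsC1Solution.exists_abs_u_le (hT : 0 < T) {M B₀ : ℝ} (hM : 0 ≤ M)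
    (hρ : ∀ t ∈ Ico 0 T, ∀ x, 0 ≤ ρ t x ∧ ρ t x ≤ M) (hB₀ : ∀ x, |u 0 x| ≤ B₀) :
    ∃ V, 0 ≤ V ∧ ∀ t ∈ Ico 0 T, ∀ x, |u t x| ≤ V := by
  set c := u 0 0 with hc
  have hT0 : (0 : ℝ) ∈ Ico 0 T := ⟨le_rfl, hT⟩
  have hrange : ((fun p : ℝ × ℝ => u p.1 p.2) '' strip T).OrdConnected := by
    refine IsPreconnected.ordConnected (IsPreconnected.image ?_ _ hs.c1_u.continuousOn)
    exact ((convex_Ico 0 T).prod convex_univ).isPreconnected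
  have hmem : ∀ t ∈ Ico 0 T, ∀ x, u t x ∈ (fun p : ℝ × ℝ => u p.1 p.2) '' strip T :=
    fun t ht x => ⟨(t, x), by simpa using ht, rfl⟩
  have hanti : AntitoneOn f ((fun p : ℝ × ℝ => u p.1 p.2) '' strip T) := by
    have hd : Differentiable ℝ f := hf.differentiable (by simp)
    refine antitoneOn_of_deriv_nonpos hrange.convex hd.continuous.continuousOn
      hd.differentiableOn fun y hy => ?_
    obtain ⟨p, hp, rfl⟩ := interior_subset hy
    exact hfu p.1 (mem_strip.1 hp) p.2
  set A := M * |f c - c| with hA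
  have hA0 : 0 ≤ A := mul_nonneg hM (abs_nonneg _)
  have hB00 : 0 ≤ B₀ := (abs_nonneg _).trans (hB₀ 0)
  have hB1 : ∀ x, |u 0 x - c| ≤ 2 * B₀ := fun x => by
    have := abs_sub (u 0 x) c
    linarith [hB₀ x, hB₀ 0]
  -- upper and lower barriers for `u - c`; the slope `A + 1` makes the comparison strict
  have key : ∀ σ : ℝ, σ = 1 ∨ σ = -1 → ∀ t ∈ Ico 0 T, ∀ x,
      σ * (u t x - c) ≤ 2 * B₀ + (A + 1) * t := by
    intro σ hσ t ht x
    obtain ⟨X, hX, rfl⟩ := (hs.isSpeed_u hb).exists_characteristic ht x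
    have hd : ∀ r ∈ Ico 0 T, HasDerivWithinAt (fun r => σ * (u r (X r) - c))
        (σ * (ρ r (X r) * (f (u r (X r)) - u r (X r)))) (Ico 0 T) r := fun r hr =>
      (((hs.transport_u hf X hX r hr).sub_const c)).const_mul σ
    have hsub : Icc 0 t ⊆ Ico 0 T := fun r hr => ⟨hr.1, hr.2.trans_lt ht.2⟩
    refine image_le_of_deriv_right_lt_deriv_boundary' (a := 0) (b := t)
      (f := fun r => σ * (u r (X r) - c)) (B := fun r => 2 * B₀ + (A + 1) * r)
      (B' := fun _ => A + 1)
      (f' := fun r => σ * (ρ r (X r) * (f (u r (X r)) - u r (X r))))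
      (fun r hr => ((hd r (hsub hr)).mono hsub).continuousWithinAt) (fun r hr => ?_) ?_
      (by fun_prop) (fun r _ => ?_) (fun r hr heq => ?_) ⟨ht.1, le_rfl⟩
    · have hr' : r ∈ Ico 0 T := hsub (Ico_subset_Icc_self hr)
      refine (hd r hr').mono_of_mem_nhdsWithin ?_
      filter_upwards [self_mem_nhdsWithin, mem_nhdsWithin_of_mem_nhds (Iio_mem_nhds hr'.2)]
        with q h1 h2
      exact ⟨hr'.1.trans h1, h2⟩
    · have h1 := abs_le.1 (hB1 (X 0))
      rcases hσ with rfl | rfl <;> simp only [mul_zero, add_zero] <;> linarith [h1.1, h1.2]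
    · simpa using (((hasDerivAt_id r).const_mul (A + 1)).const_add (2 * B₀)).hasDerivWithinAt
    · have hr' : r ∈ Ico 0 T := hsub (Ico_subset_Icc_self hr)
      have hnn : 0 ≤ σ * (u r (X r) - c) := by
        rw [heq]; have := hr.1; positivity
      have hlt : σ * (f (u r (X r)) - u r (X r)) ≤ |f c - c| := by
        rcases hσ with rfl | rfl
        · have hle : c ≤ u r (X r) := by linarith
          have := hanti (hmem 0 hT0 0) (hmem r hr' (X r)) hle
          linarith [le_abs_self (f c - c)]
        · have hle : u r (X r) ≤ c := by linarith
          have := hanti (hmem r hr' (X r)) (hmem 0 hT0 0) hle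
          linarith [neg_abs_le (f c - c)]
      obtain ⟨hr0, hrM⟩ := hρ r hr' (X r)
      have h1 : ρ r (X r) * (σ * (f (u r (X r)) - u r (X r))) ≤ A :=
        (mul_le_mul_of_nonneg_left hlt hr0).trans
          (mul_le_mul_of_nonneg_right hrM (abs_nonneg _))
      have : σ * (ρ r (X r) * (f (u r (X r)) - u r (X r)))
          = ρ r (X r) * (σ * (f (u r (X r)) - u r (X r))) := by ring
      rw [this]
      linarith
  refine ⟨3 * B₀ + (A + 1) * T, by positivity, fun t ht x => abs_le.2 ?_⟩
  have h1 := key 1 (Or.inl rfl) t ht x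
  have h2 := key (-1) (Or.inr rfl) t ht x
  have h3 : (A + 1) * t ≤ (A + 1) * T := mul_le_mul_of_nonneg_left ht.2.le (by linarith)
  have h4 := abs_le.1 (hB₀ 0)
  constructor <;> linarith [h4.1, h4.2]

end Solution

/-! ### Bounds of the gradient and limits at the final time -/

section Gradient

/-- The source in the equation of `ρ_x` along the field `f(u)`. -/
noncomputable def rhoXSource (f : ℝ → ℝ) (ρ u : ℝ → ℝ → ℝ) (t x : ℝ) : ℝ :=
  deriv (deriv f) (u t x) * (eField ρ u t x - ρ t x) * (ρ t x - eField ρ u t x) * ρ t x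
    + deriv f (u t x) * ((deriv (ρ t) x - deriv (eField ρ u t) x) * ρ t x
      + 2 * (ρ t x - eField ρ u t x) * deriv (ρ t) x)

/-- The source in the equation of `e_x` along the field `u`. -/
noncomputable def eXSource (ρ u : ℝ → ℝ → ℝ) (t x : ℝ) : ℝ :=
  (deriv (ρ t) x - deriv (eField ρ u t) x) * eField ρ u t x
    + 2 * (ρ t x - eField ρ u t x) * deriv (eField ρ u t) x

variable {f : ℝ → ℝ} {T : ℝ} {ρ u : ℝ → ℝ → ℝ}
variable (hf : ContDiff ℝ ∞ f) (hs : IsC1Solution f (Ico 0 T) ρ u)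
  (hb : IsLocallyBoundedC1 (Ico 0 T) ρ u) (he : IsC1On (Ico 0 T) (eField ρ u))

include hf hs hb he in
lemma IsC1Solution.transport_rhoX :
    IsTransported T (fun t x => f (u t x)) (fun t x => deriv (ρ t) x) (rhoXSource f ρ u) := by
  have hf1 : ContDiff ℝ 1 f := hf.of_le (by norm_cast)
  have hf2 : ContDiff ℝ 1 (deriv f) := (contDiff_deriv_of_smooth hf).of_le (by norm_cast)
  have hu := hs.c1_u.isC1InSpace
  have hr := hs.c1_rho.isC1InSpace
  have he' := he.isC1InSpace
  refine ((hs.transport_rho hf).space_deriv (hs.isSpeed_fu hf hb) hr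
    (((hu.comp hf2).mul (hr.sub he')).mul hr)).congr fun t ht x => ?_
  have h1 := (((hasDerivAt_comp_contDiff hf2 (hu.hasDerivAt ht x)).mul
    ((hr.hasDerivAt ht x).sub (he'.hasDerivAt ht x))).mul (hr.hasDerivAt ht x)).deriv
  have h2 := (hasDerivAt_comp_contDiff hf1 (hu.hasDerivAt ht x)).deriv
  have h3 : deriv (u t) x = eField ρ u t x - ρ t x := by simp [eField]
  simp only [Pi.mul_def, Pi.sub_def] at h1
  rw [h1, h2, h3, rhoXSource]
  ring

include hf hs hb he in
lemma IsC1Solution.transport_eX :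
    IsTransported T u (fun t x => deriv (eField ρ u t) x) (eXSource ρ u) := by
  have hu := hs.c1_u.isC1InSpace
  have hr := hs.c1_rho.isC1InSpace
  have he' := he.isC1InSpace
  refine ((hs.transport_e hf hb).space_deriv (hs.isSpeed_u hb) he'
    ((hr.sub he').mul he')).congr fun t ht x => ?_
  have h1 := (((hr.hasDerivAt ht x).sub (he'.hasDerivAt ht x)).mul (he'.hasDerivAt ht x)).deriv
  have h3 : deriv (u t) x = eField ρ u t x - ρ t x := by simp [eField]
  simp only [Pi.mul_def, Pi.sub_def] at h1
  rw [h1, h3, eXSource]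
  ring

lemma abs_mul_le_mul {a b A B : ℝ} (ha : |a| ≤ A) (hb : |b| ≤ B) : |a * b| ≤ A * B := by
  rw [abs_mul]
  exact mul_le_mul ha hb (abs_nonneg _) ((abs_nonneg _).trans ha)

lemma abs_sub_le_two_mul {a b A : ℝ} (ha : |a| ≤ A) (hb : |b| ≤ A) : |a - b| ≤ 2 * A := by
  linarith [abs_sub a b]

/-- The equations of `ρ_x` and `e_x` are linear in these quantities, with bounded coefficients as
long as `ρ` and `e` are bounded. -/
lemma abs_sources_le {t x A W : ℝ} (hA : 1 ≤ A) (hW : 1 ≤ W)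
    (h1 : |ρ t x| ≤ A) (h2 : |eField ρ u t x| ≤ A) (h3 : |deriv f (u t x)| ≤ A)
    (h4 : |deriv (deriv f) (u t x)| ≤ A) (hr : |deriv (ρ t) x| ≤ W)
    (hg : |deriv (eField ρ u t) x| ≤ W) :
    |rhoXSource f ρ u t x| ≤ (4 * A ^ 4 + 6 * A ^ 2) * W ∧
      |eXSource ρ u t x| ≤ (4 * A ^ 4 + 6 * A ^ 2) * W := by
  have h5 := abs_sub_le_two_mul h1 h2
  have h6 := abs_sub_le_two_mul h2 h1
  have h7 := abs_sub_le_two_mul hr hg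
  have h8 : |2 * (ρ t x - eField ρ u t x)| ≤ 2 * (2 * A) := abs_mul_le_mul (by simp) h5
  have hA2 : A ≤ A ^ 2 := by nlinarith
  have hA4 : 0 ≤ A ^ 4 := by positivity
  constructor
  · have h9 := abs_mul_le_mul (abs_mul_le_mul (abs_mul_le_mul h4 h6) h5) h1
    have h10 := abs_mul_le_mul h3 ((abs_add_le _ _).trans
      (add_le_add (abs_mul_le_mul h7 h1) (abs_mul_le_mul h8 hr)))
    refine (abs_add_le _ _).trans ((add_le_add h9 h10).trans ?_)
    nlinarith
  · refine (abs_add_le _ _).trans ((add_le_add (abs_mul_le_mul h7 h2) (abs_mul_le_mul h8 hg)).trans ?_)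
    nlinarith

include hf hs hb he in
/-- A bound of `e` on a cone gives bounds of `ρ_x` and `e_x` there which depend neither on the cone
nor on its height `τ < T`. -/
theorem IsC1Solution.abs_gradient_le {c R V A C₀ τ : ℝ} (hτ : τ ∈ Ico 0 T)
    (hV : ∀ t ∈ Ico 0 T, ∀ x, |u t x| ≤ V ∧ |f (u t x)| ≤ V) (hA : 1 ≤ A)
    (hfA : ∀ t ∈ Ico 0 T, ∀ x, |deriv f (u t x)| ≤ A ∧ |deriv (deriv f) (u t x)| ≤ A)
    (hcone : ∀ t x, (t, x) ∈ cone c R V τ → |ρ t x| ≤ A ∧ |eField ρ u t x| ≤ A) (hC₀ : 1 ≤ C₀)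
    (h0 : ∀ x, |deriv (ρ 0) x| ≤ C₀ ∧ |deriv (eField ρ u 0) x| ≤ C₀) {t x : ℝ}
    (htx : (t, x) ∈ cone c R V τ) :
    |deriv (ρ t) x| ≤ C₀ * Real.exp ((4 * A ^ 4 + 6 * A ^ 2 + 1) * t) ∧
      |deriv (eField ρ u t) x| ≤ C₀ * Real.exp ((4 * A ^ 4 + 6 * A ^ 2 + 1) * t) := by
  have hsub : ∀ t ∈ Icc 0 τ, t ∈ Ico 0 T := fun t ht => ⟨ht.1, ht.2.trans_lt hτ.2⟩
  have hV0 : 0 ≤ V := (abs_nonneg _).trans (hV 0 ⟨le_rfl, hτ.1.trans_lt hτ.2⟩ 0).1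
  -- the four quantities `± ρ_x`, `± e_x`; the exponent exceeds the constant of `abs_sources_le`
  -- by `1`, because the maximum principle needs a strict inequality
  have key := fun i => le_of_transported_of_source_lt (ι := Bool × Bool) (c := c) (R := R)
    (V := V) (τ := τ) (lam := 4 * A ^ 4 + 6 * A ^ 2 + 1) (C := C₀)
    (v := fun i => cond i.1 (fun t x => f (u t x)) u)
    (w := fun i t x => cond i.2 1 (-1) *
      cond i.1 (fun t x => deriv (ρ t) x) (fun t x => deriv (eField ρ u t) x) t x)
    (h := fun i t x => cond i.2 1 (-1) * cond i.1 (rhoXSource f ρ u) (eXSource ρ u) t x)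
    ?_ hτ hV0 ?_ (by positivity) (by linarith) ?_ ?_ ?_ ?_ htx i
  · have h1 := key (true, true)
    have h2 := key (true, false)
    have h3 := key (false, true)
    have h4 := key (false, false)
    simp only [cond_true, cond_false, one_mul] at h1 h2 h3 h4
    constructor <;> rw [abs_le] <;> constructor <;> linarith
  · rintro ⟨i, j⟩
    cases i
    exacts [hs.isSpeed_u hb, hs.isSpeed_fu hf hb]
  · rintro ⟨i, j⟩ t ht x
    cases i
    exacts [(hV t (hsub t ht) x).1, (hV t (hsub t ht) x).2]
  · rintro ⟨i, j⟩
    cases i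
    exacts [continuousOn_const.mul he.isC1InSpace.cont_deriv,
      continuousOn_const.mul hs.c1_rho.isC1InSpace.cont_deriv]
  · rintro ⟨i, j⟩
    cases i
    exacts [(hs.transport_eX hf hb he).const_mul _, (hs.transport_rhoX hf hb he).const_mul _]
  · rintro ⟨i, j⟩ x
    have h1 := abs_le.1 (h0 x).1
    have h2 := abs_le.1 (h0 x).2
    cases i <;> cases j <;> simp only [cond_true, cond_false] <;> linarith [h1.1, h1.2, h2.1, h2.2]
  · rintro ⟨i, j⟩ s y hsy hmax hlt
    obtain ⟨hρA, heA⟩ := hcone s y hsy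
    obtain ⟨hf1, hf2⟩ := hfA s (hsub s hsy.1) y
    set W := cond j 1 (-1) *
      cond i (fun t x => deriv (ρ t) x) (fun t x => deriv (eField ρ u t) x) s y with hW
    have hW1 : 1 ≤ W := hC₀.trans hlt.le
    have m1 := hmax (true, true)
    have m2 := hmax (true, false)
    have m3 := hmax (false, true)
    have m4 := hmax (false, false)
    simp only [cond_true, cond_false, one_mul] at m1 m2 m3 m4
    obtain ⟨k1, k2⟩ := abs_sources_le hA hW1 hρA heA hf1 hf2 (abs_le.2 ⟨by linarith, m1⟩)
      (abs_le.2 ⟨by linarith, m3⟩)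
    have k1' := abs_le.1 k1
    have k2' := abs_le.1 k2
    show _ < (4 * A ^ 4 + 6 * A ^ 2 + 1) * W
    cases i <;> cases j <;> simp only [cond_true, cond_false] <;>
      linarith [k1'.1, k1'.2, k2'.1, k2'.2]

end Gradient

section Limit

lemma exists_mul_sub_lt {T V H η : ℝ} (hT : 0 < T) (hη : 0 < η) :
    ∃ s ∈ Ico 0 T, V * (T - s) ≤ 1 / 2 ∧ H * (T - s) < η := by
  have h1 : Tendsto (fun s => V * (T - s)) (𝓝[<] T) (𝓝 (V * (T - T))) :=
    (Continuous.tendsto (by fun_prop) T).mono_left nhdsWithin_le_nhds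
  have h2 : Tendsto (fun s => H * (T - s)) (𝓝[<] T) (𝓝 (H * (T - T))) :=
    (Continuous.tendsto (by fun_prop) T).mono_left nhdsWithin_le_nhds
  rw [sub_self, mul_zero] at h1 h2
  obtain ⟨s, ⟨h3, h4⟩, h5⟩ := ((h1.eventually (gt_mem_nhds (by norm_num : (0 : ℝ) < 1 / 2))).and
    (h2.eventually (gt_mem_nhds hη))).and (Ico_mem_nhdsLT hT) |>.exists
  exact ⟨s, h5, h3.le, h4⟩

/-- A quantity with bounded source near `(T, c)` has a limit there. Going back from two nearby
points along the characteristics to a common time `s` close to `T` changes its values little, and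
leads to nearby points, at which the continuous function `w s` takes close values. -/
theorem exists_tendsto_of_transported {T V L H c : ℝ} {v w h : ℝ → ℝ → ℝ} (hT : 0 < T)
    (hv : IsSpeed T v) (hV : ∀ t ∈ Ico 0 T, ∀ x, |v t x| ≤ V)
    (hw : ContinuousOn (fun p : ℝ × ℝ => w p.1 p.2) (strip T)) (htr : IsTransported T v w h)
    (hL : ∀ t ∈ Ico 0 T, ∀ x, |x - c| ≤ 1 → |deriv (v t) x| ≤ L)
    (hH : ∀ t ∈ Ico 0 T, ∀ x, |x - c| ≤ 1 → |h t x| ≤ H) :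
    ∃ l, Tendsto (fun p : ℝ × ℝ => w p.1 p.2) (𝓝[strip T] (T, c)) (𝓝 l) := by
  have hT0 : (0 : ℝ) ∈ Ico 0 T := ⟨le_rfl, hT⟩
  have hV0 : 0 ≤ V := (abs_nonneg _).trans (hV 0 hT0 0)
  have hL0 : 0 ≤ L := (abs_nonneg _).trans (hL 0 hT0 c (by simp))
  have hH0 : 0 ≤ H := (abs_nonneg _).trans (hH 0 hT0 c (by simp))
  have hne : (𝓝[strip T] (T, c)).NeBot := by
    rw [← mem_closure_iff_nhdsWithin_neBot, strip, closure_prod_eq, closure_Ico hT.ne]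
    exact ⟨right_mem_Icc.2 hT.le, by simp⟩
  rw [← cauchy_map_iff_exists_tendsto, Metric.cauchy_iff]
  refine ⟨inferInstance, fun ε hε => ?_⟩
  obtain ⟨s, hs, hsV, hsH⟩ := exists_mul_sub_lt (V := V) (H := H) hT (by positivity : 0 < ε / 3)
  have hws : ContinuousOn (w s) (Icc (c - 1) (c + 1)) :=
    hw.comp (f := fun y => (s, y)) (by fun_prop) fun y _ => by simpa using hs
  obtain ⟨δ, hδ, huc⟩ := Metric.uniformContinuousOn_iff.1
    (isCompact_Icc.uniformContinuousOn_of_continuous hws) (ε / 3) (by positivity)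
  set E := Real.exp (L * T) with hE
  have hE0 : 0 < E := Real.exp_pos _
  have hη : 0 < δ / (4 * E) := by positivity
  obtain ⟨s', hs', -, hs'V⟩ := exists_mul_sub_lt (V := 0) (H := V) hT hη
  -- the part of the characteristic through a point near `(T, c)` after the time `s`
  have hback : ∀ t ∈ Ico 0 T, s ≤ t → ∀ Z, IsCharacteristic v T Z → |Z t - c| ≤ 1 / 2 →
      (∀ r ∈ Icc s t, |Z r - c| ≤ 1) ∧ |w t (Z t) - w s (Z s)| < ε / 3 := by
    intro t ht hst Z hZ hZc
    have hr : ∀ r ∈ Icc s t, r ∈ Ico 0 T := fun r hr => ⟨hs.1.trans hr.1, hr.2.trans_lt ht.2⟩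
    have h1 : ∀ r ∈ Icc s t, |Z r - c| ≤ 1 := by
      intro r hrm
      have h2 := hZ.abs_sub_le_mul (hr r hrm).1 hrm.2 ht.2
        fun q hq => hV q (hr q ⟨hrm.1.trans hq.1, hq.2⟩) _
      have h3 : V * (t - r) ≤ V * (T - s) :=
        mul_le_mul_of_nonneg_left (by linarith [ht.2, hrm.1]) hV0
      have h4 := abs_sub_le (Z r) (Z t) c
      rw [abs_sub_comm (Z r) (Z t)] at h4
      linarith
    refine ⟨h1, ?_⟩
    have h2 := (convex_Icc s t).norm_image_sub_le_of_norm_hasDerivWithin_le (C := H)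
      (fun r hrm => (htr Z hZ r (hr r hrm)).mono hr) (fun r hrm => hH r (hr r hrm) _ (h1 r hrm))
      (left_mem_Icc.2 hst) (right_mem_Icc.2 hst)
    rw [Real.norm_eq_abs, Real.norm_eq_abs, abs_of_nonneg (sub_nonneg.2 hst)] at h2
    refine h2.trans_lt (lt_of_le_of_lt ?_ hsH)
    exact mul_le_mul_of_nonneg_left (by linarith [ht.2]) hH0
  set N : Set (ℝ × ℝ) := {p | p.1 ∈ Ico 0 T ∧ s ≤ p.1 ∧ s' ≤ p.1 ∧ |p.2 - c| ≤ 1 / 2 ∧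
    |p.2 - c| < δ / (4 * E)} with hN
  have hNmem : N ∈ 𝓝[strip T] (T, c) := by
    have hcont : Tendsto (fun p : ℝ × ℝ => |p.2 - c|) (𝓝[strip T] (T, c)) (𝓝 |c - c|) :=
      ((by fun_prop : Continuous fun p : ℝ × ℝ => |p.2 - c|).tendsto (T, c)).mono_left
        nhdsWithin_le_nhds
    have hfst : Tendsto (fun p : ℝ × ℝ => p.1) (𝓝[strip T] (T, c)) (𝓝 T) :=
      (continuous_fst.tendsto (T, c)).mono_left nhdsWithin_le_nhds
    rw [sub_self, abs_zero] at hcont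
    filter_upwards [self_mem_nhdsWithin, hfst.eventually (lt_mem_nhds hs.2),
      hfst.eventually (lt_mem_nhds hs'.2),
      hcont.eventually (gt_mem_nhds (by norm_num : (0 : ℝ) < 1 / 2)),
      hcont.eventually (gt_mem_nhds hη)] with p h1 h2 h3 h4 h5
    exact ⟨mem_strip.1 h1, h2.le, h3.le, h4.le, h5⟩
  have key : ∀ p ∈ N, ∀ q ∈ N, p.1 ≤ q.1 → |w p.1 p.2 - w q.1 q.2| < ε := by
    rintro ⟨t₁, y₁⟩ ⟨ht₁, hst₁, hst₁', hy₁, hy₁'⟩ ⟨t₂, y₂⟩ ⟨ht₂, hst₂, -, hy₂, hy₂'⟩ h12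
    simp only at *
    obtain ⟨Z, hZ, rfl⟩ := hv.exists_characteristic ht₁ y₁
    obtain ⟨Y, hY, rfl⟩ := hv.exists_characteristic ht₂ y₂
    obtain ⟨hZ1, hZw⟩ := hback t₁ ht₁ hst₁ Z hZ hy₁
    obtain ⟨hY1, hYw⟩ := hback t₂ ht₂ hst₂ Y hY hy₂
    have h1 := (abs_sub_le_of_abs_deriv_le (v := v) (L := L) (A := fun _ => Icc (c - 1) (c + 1))
      (Z := Z) (W := Y) hst₁ (fun r hr => hZ.hasDerivWithinAt_Icc hs.1 ht₁.2 hr)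
      (fun r hr => hY.hasDerivWithinAt_Icc hs.1 ht₁.2 hr)
      (fun r hr => hv.diff r ⟨hs.1.trans hr.1, hr.2.trans_lt ht₁.2⟩) (fun _ _ => convex_Icc _ _)
      (fun r hr x hx => hL r ⟨hs.1.trans hr.1, hr.2.trans_lt ht₁.2⟩ x
        (abs_le.2 ⟨by linarith [hx.1], by linarith [hx.2]⟩))
      (fun r hr => by
        have := abs_le.1 (hZ1 r hr); exact ⟨by linarith [this.1], by linarith [this.2]⟩)
      (fun r hr => by
        have := abs_le.1 (hY1 r ⟨hr.1, hr.2.trans h12⟩)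
        exact ⟨by linarith [this.1], by linarith [this.2]⟩)).2
    have h2 : Real.exp (L * (t₁ - s)) ≤ E :=
      Real.exp_le_exp.2 (mul_le_mul_of_nonneg_left (by linarith [ht₁.2, hs.1]) hL0)
    have h3 : |Z t₁ - Y t₁| < 3 * (δ / (4 * E)) := by
      have h4 := hY.abs_sub_le_mul ht₁.1 h12 ht₂.2
        fun r hr => hV r ⟨ht₁.1.trans hr.1, hr.2.trans_lt ht₂.2⟩ _
      have h5 : V * (t₂ - t₁) ≤ V * (T - s') :=
        mul_le_mul_of_nonneg_left (by linarith [ht₂.2]) hV0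
      have h6 : |Z t₁ - Y t₁| ≤ |Z t₁ - c| + |Y t₂ - c| + |Y t₂ - Y t₁| := by
        have e1 := abs_sub_le (Z t₁) c (Y t₁)
        have e2 := abs_sub_le c (Y t₂) (Y t₁)
        rw [abs_sub_comm c (Y t₂)] at e2
        linarith
      linarith
    have h4 : |Z s - Y s| < δ := by
      refine h1.trans_lt ((mul_le_mul_of_nonneg_right h2 (abs_nonneg _)).trans_lt
        ((mul_lt_mul_of_pos_left h3 hE0).trans ?_))
      have : E * (3 * (δ / (4 * E))) = 3 / 4 * δ := by field_simp
      rw [this]; linarith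
    have hsI : ∀ Z : ℝ → ℝ, |Z s - c| ≤ 1 → Z s ∈ Icc (c - 1) (c + 1) := fun Z h => by
      have := abs_le.1 h; exact ⟨by linarith [this.1], by linarith [this.2]⟩
    have h5 := huc (Z s) (hsI Z (hZ1 s ⟨le_rfl, hst₁⟩)) (Y s) (hsI Y (hY1 s ⟨le_rfl, hst₂⟩))
      (by rwa [Real.dist_eq])
    rw [Real.dist_eq] at h5
    have e1 := abs_sub_le (w t₁ (Z t₁)) (w s (Z s)) (w t₂ (Y t₂))
    have e2 := abs_sub_le (w s (Z s)) (w s (Y s)) (w t₂ (Y t₂))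
    rw [abs_sub_comm (w s (Y s))] at e2
    linarith
  refine ⟨_, image_mem_map hNmem, ?_⟩
  rintro _ ⟨p, hp, rfl⟩ _ ⟨q, hq, rfl⟩
  rw [Real.dist_eq]
  rcases le_total p.1 q.1 with h | h
  · exact key p hp q hq h
  · rw [abs_sub_comm]; exact key q hq p hp h

end Limit

/-! ### Continuation to the final time -/

section Extension

variable {T : ℝ}

/-- `w` is continuous on `[0, T) × ℝ` and has a limit at every point of the line `t = T`. -/
structure HasFinalLimits (T : ℝ) (w : ℝ → ℝ → ℝ) : Prop where
  cont : ContinuousOn (fun p : ℝ × ℝ => w p.1 p.2) (strip T)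
  lim : ∀ c, ∃ l, Tendsto (fun p : ℝ × ℝ => w p.1 p.2) (𝓝[strip T] (T, c)) (𝓝 l)

/-- The extension of `w` from `[0, T) × ℝ` by its limits at the time `T`; it is meaningful under
`HasFinalLimits T w`. -/
noncomputable def finalExtend (T : ℝ) (w : ℝ → ℝ → ℝ) (t x : ℝ) : ℝ :=
  extendFrom (strip T) (fun p : ℝ × ℝ => w p.1 p.2) (t, x)

lemma closure_strip (hT : 0 < T) : closure (strip T) = Icc 0 T ×ˢ univ := by
  rw [strip, closure_prod_eq, closure_Ico hT.ne, closure_univ]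

lemma HasFinalLimits.sub {w w' : ℝ → ℝ → ℝ} (hw : HasFinalLimits T w) (hw' : HasFinalLimits T w') :
    HasFinalLimits T (fun t x => w t x - w' t x) where
  cont := hw.cont.sub hw'.cont
  lim c := by
    obtain ⟨l, hl⟩ := hw.lim c
    obtain ⟨l', hl'⟩ := hw'.lim c
    exact ⟨_, hl.sub hl'⟩

lemma HasFinalLimits.mul {w w' : ℝ → ℝ → ℝ} (hw : HasFinalLimits T w) (hw' : HasFinalLimits T w') :
    HasFinalLimits T (fun t x => w t x * w' t x) where
  cont := hw.cont.mul hw'.cont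
  lim c := by
    obtain ⟨l, hl⟩ := hw.lim c
    obtain ⟨l', hl'⟩ := hw'.lim c
    exact ⟨_, hl.mul hl'⟩

lemma HasFinalLimits.comp {w : ℝ → ℝ → ℝ} (hw : HasFinalLimits T w) {g : ℝ → ℝ}
    (hg : Continuous g) : HasFinalLimits T (fun t x => g (w t x)) where
  cont := hg.comp_continuousOn hw.cont
  lim c := by
    obtain ⟨l, hl⟩ := hw.lim c
    exact ⟨_, (hg.tendsto l).comp hl⟩

lemma HasFinalLimits.congr {w w' : ℝ → ℝ → ℝ} (hw : HasFinalLimits T w)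
    (h : ∀ t ∈ Ico 0 T, ∀ x, w' t x = w t x) : HasFinalLimits T w' where
  cont := hw.cont.congr fun p hp => h p.1 (mem_strip.1 hp) p.2
  lim c := by
    obtain ⟨l, hl⟩ := hw.lim c
    refine ⟨l, hl.congr' ?_⟩
    filter_upwards [self_mem_nhdsWithin] with p hp
    exact (h p.1 (mem_strip.1 hp) p.2).symm

lemma HasFinalLimits.finalExtend_eq {w : ℝ → ℝ → ℝ} (hw : HasFinalLimits T w) {t : ℝ}
    (ht : t ∈ Ico 0 T) : finalExtend T w t = w t :=
  funext fun x => extendFrom_extends hw.cont (t, x) (by simpa using ht)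

lemma HasFinalLimits.continuousOn_finalExtend {w : ℝ → ℝ → ℝ} (hT : 0 < T)
    (hw : HasFinalLimits T w) :
    ContinuousOn (fun p : ℝ × ℝ => finalExtend T w p.1 p.2) (Icc 0 T ×ˢ univ) := by
  refine continuousOn_extendFrom (closure_strip hT).ge ?_
  rintro ⟨t, x⟩ ⟨ht, -⟩
  rcases eq_or_lt_of_le ht.2 with h | h
  · simp only at h
    subst h
    exact hw.lim x
  · exact ⟨_, hw.cont (t, x) (by simpa using ⟨ht.1, h⟩)⟩

lemma strip_subset_Icc (T : ℝ) : strip T ⊆ Icc 0 T ×ˢ univ :=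
  prod_mono Ico_subset_Icc_self subset_rfl

/-- An identity between continuous functions extends from `[0, T) × ℝ` to the final time. -/
lemma eq_of_eq_strip (hT : 0 < T) {w w' : ℝ → ℝ → ℝ}
    (hw : ContinuousOn (fun p : ℝ × ℝ => w p.1 p.2) (Icc 0 T ×ˢ univ))
    (hw' : ContinuousOn (fun p : ℝ × ℝ => w' p.1 p.2) (Icc 0 T ×ˢ univ))
    (h : ∀ t ∈ Ico 0 T, ∀ x, w t x = w' t x) {t : ℝ} (ht : t ∈ Icc 0 T) (x : ℝ) :
    w t x = w' t x :=
  EqOn.of_subset_closure (s := strip T) (fun p hp => h p.1 (mem_strip.1 hp) p.2) hw hw'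
    (strip_subset_Icc T) (closure_strip hT).ge (x := (t, x)) ⟨ht, mem_univ _⟩

lemma HasFinalLimits.abs_finalExtend_le {w : ℝ → ℝ → ℝ} (hT : 0 < T) (hw : HasFinalLimits T w)
    {C : ℝ} (hC : ∀ t ∈ Ico 0 T, ∀ x, |w t x| ≤ C) {t : ℝ} (ht : t ∈ Icc 0 T) (x : ℝ) :
    |finalExtend T w t x| ≤ C := by
  have h1 : (t, x) ∈ Icc 0 T ×ˢ (univ : Set ℝ) := ⟨ht, mem_univ _⟩
  have hne : (𝓝[strip T] (t, x)).NeBot := by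
    rw [← mem_closure_iff_nhdsWithin_neBot, closure_strip hT]; exact h1
  refine le_of_tendsto (((hw.continuousOn_finalExtend hT (t, x) h1).mono (strip_subset_Icc T)).abs)
    ?_
  filter_upwards [self_mem_nhdsWithin] with p hp
  rw [hw.finalExtend_eq (mem_strip.1 hp)]
  exact hC _ (mem_strip.1 hp) _

/-- If a `C^1` function has limits at the final time together with its first derivatives, then
its extension is `C^1` up to the final time. -/
theorem IsC1On.finalExtend (hT : 0 < T) {w a : ℝ → ℝ → ℝ} (hw : IsC1On (Ico 0 T) w)
    (hl : HasFinalLimits T w) (hx : HasFinalLimits T (fun t x => deriv (w t) x))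
    (ha : HasFinalLimits T a) (hta : ∀ t ∈ Ioo 0 T, ∀ x, deriv (fun s => w s x) t = a t x) :
    IsC1On (Icc 0 T) (finalExtend T w) ∧ ∀ t ∈ Icc 0 T, ∀ x,
      HasDerivAt (finalExtend T w t) (finalExtend T (fun t x => deriv (w t) x) t x) x := by
  set S : Set (ℝ × ℝ) := Icc 0 T ×ˢ univ with hS
  set Ω : Set (ℝ × ℝ) := Ioo 0 T ×ˢ univ with hΩ
  set F : ℝ × ℝ → ℝ := fun p => _root_.finalExtend T w p.1 p.2 with hF
  set G : ℝ × ℝ → ℝ × ℝ →L[ℝ] ℝ := fun p =>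
    _root_.finalExtend T a p.1 p.2 • ContinuousLinearMap.fst ℝ ℝ ℝ +
      _root_.finalExtend T (fun t x => deriv (w t) x) p.1 p.2 • ContinuousLinearMap.snd ℝ ℝ ℝ
    with hG
  have hΩS : Ω ⊆ S := prod_mono Ioo_subset_Icc_self subset_rfl
  have hclos : closure Ω = S := by rw [hΩ, closure_prod_eq, closure_Ioo hT.ne, closure_univ]
  have hΩo : IsOpen Ω := isOpen_Ioo.prod isOpen_univ
  have hFc : ContinuousOn F S := hl.continuousOn_finalExtend hT
  have hGc : ContinuousOn G S :=
    ((ha.continuousOn_finalExtend hT).smul continuousOn_const).add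
      ((hx.continuousOn_finalExtend hT).smul continuousOn_const)
  have hfd : ∀ p ∈ Ω, HasFDerivAt F (G p) p := by
    rintro ⟨t, x⟩ ⟨ht, -⟩
    have ht' : t ∈ Ico 0 T := Ioo_subset_Ico_self ht
    have hmem : strip T ∈ 𝓝 (t, x) :=
      mem_of_superset (hΩo.mem_nhds ⟨ht, mem_univ _⟩) (prod_mono Ioo_subset_Ico_self subset_rfl)
    have h1 := (hw.hasFDerivWithinAt ht' x).hasFDerivAt hmem
    have h2 : fderivWithin ℝ (fun p : ℝ × ℝ => w p.1 p.2) (strip T) (t, x) = G (t, x) := by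
      have e1 := (hw.hasDerivAt_time ht x).deriv
      have e2 := (hw.hasDerivAt_space ht' x).deriv
      rw [hta t ht x] at e1
      refine ContinuousLinearMap.prod_ext (ContinuousLinearMap.ext_ring ?_)
        (ContinuousLinearMap.ext_ring ?_)
      · simp [hG, ← e1, ha.finalExtend_eq ht']
      · simp [hG, ← e2, hx.finalExtend_eq ht']
    rw [h2] at h1
    refine h1.congr_of_eventuallyEq ?_
    filter_upwards [hmem] with q hq
    simp only [hF]
    rw [hl.finalExtend_eq (mem_strip.1 hq)]
  have hfdS : ∀ p ∈ S, HasFDerivWithinAt F (G p) S p := by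
    intro p hp
    have := hasFDerivWithinAt_closure_of_tendsto_fderiv (f := F) (s := Ω) (x := p) (f' := G p)
      (fun q hq => (hfd q hq).differentiableAt.differentiableWithinAt)
      ((convex_Ioo 0 T).prod convex_univ) hΩo
      (fun q hq => (hFc q (by rwa [hclos] at hq)).mono hΩS) ?_
    · rwa [hclos] at this
    · refine (((hGc p hp).mono hΩS).tendsto).congr' ?_
      filter_upwards [self_mem_nhdsWithin] with q hq
      exact (hfd q hq).fderiv.symm
  have hud : UniqueDiffOn ℝ S := (uniqueDiffOn_Icc hT).prod uniqueDiffOn_univ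
  constructor
  · show ContDiffOn ℝ (0 + 1) F S
    rw [contDiffOn_succ_iff_fderivWithin hud]
    refine ⟨fun p hp => (hfdS p hp).differentiableWithinAt, by simp, ?_⟩
    rw [contDiffOn_zero]
    exact hGc.congr fun p hp => (hfdS p hp).fderivWithin (hud p hp)
  · intro t ht x
    have h1 : HasDerivWithinAt (fun y : ℝ => (t, y)) ((0 : ℝ), (1 : ℝ)) univ x :=
      ((hasDerivAt_const x t).prodMk (hasDerivAt_id x)).hasDerivWithinAt
    have h2 := (hfdS (t, x) ⟨ht, mem_univ _⟩).comp_hasDerivWithinAt x h1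
      fun y _ => ⟨ht, mem_univ _⟩
    have h3 := h2.hasDerivAt univ_mem
    simpa [hG, hF, Function.comp_def] using h3

end Extension

section Continuation

variable {f : ℝ → ℝ} {T : ℝ} {ρ u : ℝ → ℝ → ℝ}

/-- A solution with bounded `u` for which `ρ`, `e` and their space derivatives are bounded near
every point of the line `t = T` continues to the time `T`. -/
theorem IsC1Solution.exists_continuation (hf : ContDiff ℝ ∞ f)
    (hs : IsC1Solution f (Ico 0 T) ρ u) (hb : IsLocallyBoundedC1 (Ico 0 T) ρ u)
    (he : IsC1On (Ico 0 T) (eField ρ u)) (hT : 0 < T) {V : ℝ}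
    (hV : ∀ t ∈ Ico 0 T, ∀ x, |u t x| ≤ V)
    (hA : ∀ c, ∃ A, ∀ t ∈ Ico 0 T, ∀ x, |x - c| ≤ 1 → |ρ t x| ≤ A ∧ |eField ρ u t x| ≤ A ∧
      |deriv (ρ t) x| ≤ A ∧ |deriv (eField ρ u t) x| ≤ A) :
    IsC1Continuation f T ρ u (finalExtend T ρ) (finalExtend T u) ∧
      ∀ C, (∀ t ∈ Ico 0 T, ∀ x, |ρ t x| ≤ C ∧ |u t x| ≤ C ∧ |deriv (ρ t) x| ≤ C ∧
        |deriv (u t) x| ≤ C) → IsLocallyBoundedC1 (Icc 0 T) (finalExtend T ρ) (finalExtend T u) := by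
  have hf1 : ContDiff ℝ 1 f := hf.of_le (by norm_cast)
  have hf' := (contDiff_deriv_of_smooth hf).continuous
  have hf'' := (contDiff_deriv_of_smooth (contDiff_deriv_of_smooth hf)).continuous
  have hu1 := hs.c1_u.isC1InSpace
  have hr1 := hs.c1_rho.isC1InSpace
  have hux : ∀ t x, deriv (u t) x = eField ρ u t x - ρ t x := fun t x => by simp [eField]
  obtain ⟨F₀, -, hF₀⟩ := exists_abs_le_of_continuous hf.continuous V
  obtain ⟨F₁, -, hF₁⟩ := exists_abs_le_of_continuous hf' V
  obtain ⟨F₂, -, hF₂⟩ := exists_abs_le_of_continuous hf'' V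
  -- a common bound `B` near the point `(T, c)`
  have hB : ∀ c, ∃ B, 1 ≤ B ∧ V ≤ B ∧ ∀ t ∈ Ico 0 T, ∀ x, |x - c| ≤ 1 → |ρ t x| ≤ B ∧
      |eField ρ u t x| ≤ B ∧ |deriv (ρ t) x| ≤ B ∧ |deriv (eField ρ u t) x| ≤ B ∧
      |f (u t x)| ≤ B ∧ |deriv f (u t x)| ≤ B ∧ |deriv (deriv f) (u t x)| ≤ B := by
    intro c
    obtain ⟨A, hA⟩ := hA c
    refine ⟨max (max 1 V) (max A (max F₀ (max F₁ F₂))), by simp, by simp,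
      fun t ht x hx => ?_⟩
    obtain ⟨h1, h2, h3, h4⟩ := hA t ht x hx
    have h5 := hF₀ _ (hV t ht x)
    have h6 := hF₁ _ (hV t ht x)
    have h7 := hF₂ _ (hV t ht x)
    refine ⟨?_, ?_, ?_, ?_, ?_, ?_, ?_⟩ <;> simp only [le_max_iff] <;> tauto
  have hLu : ∀ c B, (∀ t ∈ Ico 0 T, ∀ x, |x - c| ≤ 1 → |ρ t x| ≤ B ∧ |eField ρ u t x| ≤ B) →
      ∀ t ∈ Ico 0 T, ∀ x, |x - c| ≤ 1 → |deriv (u t) x| ≤ 2 * B := by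
    intro c B hB t ht x hx
    rw [hux]
    exact abs_sub_le_two_mul (hB t ht x hx).2 (hB t ht x hx).1
  have limu : ∀ (w h : ℝ → ℝ → ℝ), ContinuousOn (fun p : ℝ × ℝ => w p.1 p.2) (strip T) →
      IsTransported T u w h → (∀ c, ∃ H, ∀ t ∈ Ico 0 T, ∀ x, |x - c| ≤ 1 → |h t x| ≤ H) →
      HasFinalLimits T w := by
    refine fun w h hw htr hh => ⟨hw, fun c => ?_⟩
    obtain ⟨H, hH⟩ := hh c
    obtain ⟨B, -, -, hB⟩ := hB c
    exact exists_tendsto_of_transported hT (hs.isSpeed_u hb) hV hw htr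
      (hLu c B fun t ht x hx => ⟨(hB t ht x hx).1, (hB t ht x hx).2.1⟩) hH
  have limf : ∀ (w h : ℝ → ℝ → ℝ), ContinuousOn (fun p : ℝ × ℝ => w p.1 p.2) (strip T) →
      IsTransported T (fun t x => f (u t x)) w h →
      (∀ c, ∃ H, ∀ t ∈ Ico 0 T, ∀ x, |x - c| ≤ 1 → |h t x| ≤ H) → HasFinalLimits T w := by
    refine fun w h hw htr hh => ⟨hw, fun c => ?_⟩
    obtain ⟨H, hH⟩ := hh c
    obtain ⟨B, -, -, hB⟩ := hB c
    refine exists_tendsto_of_transported (L := B * (2 * B)) hT (hs.isSpeed_fu hf hb)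
      (fun t ht x => hF₀ _ (hV t ht x)) hw htr (fun t ht x hx => ?_) hH
    rw [(hasDerivAt_comp_contDiff hf1 (hu1.hasDerivAt ht x)).deriv]
    exact abs_mul_le_mul (hB t ht x hx).2.2.2.2.2.1
      (hLu c B (fun t ht x hx => ⟨(hB t ht x hx).1, (hB t ht x hx).2.1⟩) t ht x hx)
  have lu : HasFinalLimits T u := by
    refine limu u _ hu1.cont (hs.transport_u hf) fun c => ?_
    obtain ⟨B, -, hVB, hB⟩ := hB c
    exact ⟨B * (2 * B), fun t ht x hx => abs_mul_le_mul (hB t ht x hx).1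
      (abs_sub_le_two_mul (hB t ht x hx).2.2.2.2.1 ((hV t ht x).trans hVB))⟩
  have le : HasFinalLimits T (eField ρ u) := by
    refine limu _ _ he.continuousOn (hs.transport_e hf hb) fun c => ?_
    obtain ⟨B, -, -, hB⟩ := hB c
    exact ⟨2 * B * B, fun t ht x hx => abs_mul_le_mul
      (abs_sub_le_two_mul (hB t ht x hx).1 (hB t ht x hx).2.1) (hB t ht x hx).2.1⟩
  have lr : HasFinalLimits T ρ := by
    refine limf _ _ hr1.cont (hs.transport_rho hf) fun c => ?_
    obtain ⟨B, -, -, hB⟩ := hB c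
    exact ⟨B * (2 * B) * B, fun t ht x hx => abs_mul_le_mul (abs_mul_le_mul
      (hB t ht x hx).2.2.2.2.2.1 (abs_sub_le_two_mul (hB t ht x hx).1 (hB t ht x hx).2.1))
      (hB t ht x hx).1⟩
  have hsrc : ∀ c, ∃ H, ∀ t ∈ Ico 0 T, ∀ x, |x - c| ≤ 1 →
      |rhoXSource f ρ u t x| ≤ H ∧ |eXSource ρ u t x| ≤ H := by
    intro c
    obtain ⟨B, hB1, -, hB⟩ := hB c
    refine ⟨(4 * B ^ 4 + 6 * B ^ 2) * B, fun t ht x hx => ?_⟩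
    obtain ⟨h1, h2, h3, h4, -, h6, h7⟩ := hB t ht x hx
    exact abs_sources_le hB1 hB1 h1 h2 h6 h7 h3 h4
  have lrx : HasFinalLimits T (fun t x => deriv (ρ t) x) :=
    limf _ _ hr1.cont_deriv (hs.transport_rhoX hf hb he) fun c =>
      (hsrc c).imp fun _ h t ht x hx => (h t ht x hx).1
  have lex : HasFinalLimits T (fun t x => deriv (eField ρ u t) x) :=
    limu _ _ he.isC1InSpace.cont_deriv (hs.transport_eX hf hb he) fun c =>
      (hsrc c).imp fun _ h t ht x hx => (h t ht x hx).2
  have lux : HasFinalLimits T (fun t x => deriv (u t) x) := (le.sub lr).congr fun t _ x => hux t x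
  -- the time derivatives are given by the equations
  obtain ⟨cr, dr⟩ := hs.c1_rho.finalExtend hT lr lrx (a := fun t x =>
      deriv f (u t x) * (ρ t x - eField ρ u t x) * ρ t x - f (u t x) * deriv (ρ t) x)
    ((((lu.comp hf').mul (lr.sub le)).mul lr).sub ((lu.comp hf.continuous).mul lrx))
    fun t ht x => by
      have := hs.mass t (by rwa [interior_Ico]) x
      rw [hs.deriv_flux hf (Ioo_subset_Ico_self ht), hux] at this
      linear_combination this
  obtain ⟨cu, du⟩ := hs.c1_u.finalExtend hT lu lux (a := fun t x =>
      ρ t x * (f (u t x) - u t x) - u t x * deriv (u t) x)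
    ((lr.mul ((lu.comp hf.continuous).sub lu)).sub (lu.mul lux)) fun t ht x => by
      have := hs.velocity t (by rwa [interior_Ico]) x
      linear_combination this
  obtain ⟨ce, -⟩ := he.finalExtend hT le lex (a := fun t x =>
      (ρ t x - eField ρ u t x) * eField ρ u t x - u t x * deriv (eField ρ u t) x)
    (((lr.sub le).mul le).sub (lu.mul lex)) fun t ht x => by
      -- compare the transport equation with the chain rule along a characteristic
      have ht' := Ioo_subset_Ico_self ht
      obtain ⟨X, hX, rfl⟩ := (hs.isSpeed_u hb).exists_characteristic ht' x
      have h1 := hs.transport_e hf hb X hX t ht'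
      have hX1 : HasDerivWithinAt (fun s => (s, X s)) ((1 : ℝ), u t (X t)) (Ico 0 T) t :=
        (hasDerivAt_id t).hasDerivWithinAt.prodMk (hX t ht')
      have h2 := (he.hasFDerivWithinAt ht' (X t)).comp_hasDerivWithinAt t hX1
        fun s hs => by simpa using hs
      have h3 := (uniqueDiffOn_Ico 0 T t ht').eq_deriv _ h1 h2
      have h4 : ((1 : ℝ), u t (X t)) = (1, 0) + u t (X t) • ((0 : ℝ), (1 : ℝ)) := by simp
      rw [h4, map_add, map_smul, smul_eq_mul, ← (he.hasDerivAt_time ht (X t)).deriv,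
        ← (he.hasDerivAt_space ht' (X t)).deriv] at h3
      linear_combination -h3
  have hE : ∀ t ∈ Icc 0 T, ∀ x, eField (finalExtend T ρ) (finalExtend T u) t x
      = finalExtend T (eField ρ u) t x := by
    intro t ht x
    rw [eField, (du t ht x).deriv]
    refine eq_of_eq_strip hT (w := fun t x => finalExtend T (fun t x => deriv (u t) x) t x
      + finalExtend T ρ t x) ((lux.continuousOn_finalExtend hT).add
        (lr.continuousOn_finalExtend hT)) (le.continuousOn_finalExtend hT) (fun t ht x => ?_) ht x
    rw [lux.finalExtend_eq ht, lr.finalExtend_eq ht, le.finalExtend_eq ht, eField]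
  refine ⟨⟨fun t ht => lr.finalExtend_eq ht, fun t ht => lu.finalExtend_eq ht,
    ⟨cr, cu, fun t ht x => ?_, fun t ht x => ?_⟩, ?_⟩, fun C hC τ hτ => ⟨C, fun t ht x => ?_⟩⟩
  · rw [interior_Icc] at ht
    have h1 : (fun s => finalExtend T ρ s x) =ᶠ[𝓝 t] fun s => ρ s x := by
      filter_upwards [Ioo_mem_nhds ht.1 ht.2] with s hs
      rw [lr.finalExtend_eq (Ioo_subset_Ico_self hs)]
    rw [h1.deriv_eq, lr.finalExtend_eq (Ioo_subset_Ico_self ht),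
      lu.finalExtend_eq (Ioo_subset_Ico_self ht)]
    exact hs.mass t (by rwa [interior_Ico]) x
  · rw [interior_Icc] at ht
    have h1 : (fun s => finalExtend T u s x) =ᶠ[𝓝 t] fun s => u s x := by
      filter_upwards [Ioo_mem_nhds ht.1 ht.2] with s hs
      rw [lu.finalExtend_eq (Ioo_subset_Ico_self hs)]
    rw [h1.deriv_eq, lr.finalExtend_eq (Ioo_subset_Ico_self ht),
      lu.finalExtend_eq (Ioo_subset_Ico_self ht)]
    exact hs.velocity t (by rwa [interior_Ico]) x
  · exact ce.congr fun p hp => hE p.1 hp.1 p.2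
  · have ht' : t ∈ Icc 0 T := ⟨ht.1, ht.2.trans hτ.2⟩
    rw [(dr t ht' x).deriv, (du t ht' x).deriv]
    exact ⟨lr.abs_finalExtend_le hT (fun t ht x => (hC t ht x).1) ht' x,
      lu.abs_finalExtend_le hT (fun t ht x => (hC t ht x).2.1) ht' x,
      lrx.abs_finalExtend_le hT (fun t ht x => (hC t ht x).2.2.1) ht' x,
      lux.abs_finalExtend_le hT (fun t ht x => (hC t ht x).2.2.2) ht' x⟩

end Continuation

/-! ### Breakdown -/

section Blowup

/-- A `C^1` solution on `[0, T) × ℝ` for which `e` is also `C^1`, with the bounds that hold up to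
the time `T` whether or not it blows up there: `0 ≤ ρ ≤ M`, `e ≤ M`, and the velocities are at most
`V`. At the initial time, `e` is bounded by `E`, and `ρ_x`, `e_x` by `C₀`. -/
structure IsControlledSolution (f : ℝ → ℝ) (T : ℝ) (ρ u : ℝ → ℝ → ℝ) (M V E C₀ : ℝ) : Prop where
  smooth : ContDiff ℝ ∞ f
  pos : 0 < T
  sol : IsC1Solution f (Ico 0 T) ρ u
  bdd : IsLocallyBoundedC1 (Ico 0 T) ρ u
  c1_e : IsC1On (Ico 0 T) (eField ρ u)
  M_nonneg : 0 ≤ M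
  bounds : ∀ t ∈ Ico 0 T, ∀ x, 0 ≤ ρ t x ∧ ρ t x ≤ M ∧ eField ρ u t x ≤ M
  speeds : ∀ t ∈ Ico 0 T, ∀ x, |u t x| ≤ V ∧ |f (u t x)| ≤ V
  initial_e : ∀ x, |eField ρ u 0 x| ≤ E
  one_le : 1 ≤ C₀
  initial_gradient : ∀ x, |deriv (ρ 0) x| ≤ C₀ ∧ |deriv (eField ρ u 0) x| ≤ C₀

namespace IsControlledSolution

variable {f : ℝ → ℝ} {T : ℝ} {ρ u : ℝ → ℝ → ℝ} {M V E C₀ : ℝ}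

lemma zero_mem (h : IsControlledSolution f T ρ u M V E C₀) : (0 : ℝ) ∈ Ico 0 T := ⟨le_rfl, h.pos⟩

lemma V_nonneg (h : IsControlledSolution f T ρ u M V E C₀) : 0 ≤ V :=
  (abs_nonneg _).trans (h.speeds 0 h.zero_mem 0).1

lemma E_nonneg (h : IsControlledSolution f T ρ u M V E C₀) : 0 ≤ E :=
  (abs_nonneg _).trans (h.initial_e 0)

lemma isSpeed_u (h : IsControlledSolution f T ρ u M V E C₀) : IsSpeed T u := h.sol.isSpeed_u h.bdd

/-- A lower bound of `e` on the domain of dependence of `[c - 1, c + 1]` bounds the solution and its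
gradient near `(T, c)`, uniformly in `c`. -/
lemma exists_bound (h : IsControlledSolution f T ρ u M V E C₀) (K : ℝ) : ∃ A, ∀ c,
    (∀ t ∈ Ico 0 T, ∀ x, |x - c| ≤ 1 + V * (T - t) → -K ≤ eField ρ u t x) →
    ∀ t ∈ Ico 0 T, ∀ x, |x - c| ≤ 1 → |ρ t x| ≤ A ∧ |eField ρ u t x| ≤ A ∧
      |deriv (ρ t) x| ≤ A ∧ |deriv (eField ρ u t) x| ≤ A := by
  have hf' := contDiff_deriv_of_smooth h.smooth
  obtain ⟨F₁, -, hF₁⟩ := exists_abs_le_of_continuous hf'.continuous V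
  obtain ⟨F₂, -, hF₂⟩ := exists_abs_le_of_continuous (contDiff_deriv_of_smooth hf').continuous V
  set A := max (max 1 M) (max K (max F₁ F₂)) with hA
  have hA1 : 1 ≤ A := by simp [hA]
  have hAM : M ≤ A := by simp [hA]
  have hAK : K ≤ A := by simp [hA]
  have hAF₁ : F₁ ≤ A := by simp [hA]
  have hAF₂ : F₂ ≤ A := by simp [hA]
  set G := C₀ * Real.exp ((4 * A ^ 4 + 6 * A ^ 2 + 1) * T) with hG
  refine ⟨max A G, fun c hc t ht x hx => ?_⟩
  have hVT : 0 ≤ V * (T - t) := mul_nonneg h.V_nonneg (by linarith [ht.2])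
  have hbd : ∀ s ∈ Ico 0 T, ∀ y, |y - c| ≤ 1 + V * (T - s) →
      |ρ s y| ≤ A ∧ |eField ρ u s y| ≤ A := by
    intro s hs y hy
    obtain ⟨h1, h2, h3⟩ := h.bounds s hs y
    have h4 := hc s hs y hy
    exact ⟨abs_le.2 ⟨by linarith, by linarith⟩, abs_le.2 ⟨by linarith, by linarith⟩⟩
  -- the part before the time `t` of the domain of dependence is a cone of height `t`
  have hgr := h.sol.abs_gradient_le h.smooth h.bdd h.c1_e (c := c) (R := 1 + V * (T - t)) ht
    h.speeds hA1 (fun s hs y => ⟨(hF₁ _ (h.speeds s hs y).1).trans hAF₁,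
      (hF₂ _ (h.speeds s hs y).1).trans hAF₂⟩)
    (fun s y hsy => hbd s ⟨hsy.1.1, hsy.1.2.trans_lt ht.2⟩ y (by
      have := hsy.2; simp only at this; linarith)) h.one_le h.initial_gradient (t := t) (x := x)
    ⟨⟨ht.1, le_rfl⟩, by simp only [sub_self, mul_zero]; linarith⟩
  have hGt : C₀ * Real.exp ((4 * A ^ 4 + 6 * A ^ 2 + 1) * t) ≤ G :=
    mul_le_mul_of_nonneg_left (Real.exp_le_exp.2 (mul_le_mul_of_nonneg_left ht.2.le
      (by positivity))) (by linarith [h.one_le])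
  have hb := hbd t ht x (by linarith)
  exact ⟨hb.1.trans (le_max_left _ _), hb.2.trans (le_max_left _ _),
    (hgr.1.trans hGt).trans (le_max_right _ _), (hgr.2.trans hGt).trans (le_max_right _ _)⟩

/-- Negative values of `e` decrease along characteristics. -/
lemma e_le_of_le (h : IsControlledSolution f T ρ u M V E C₀) {X : ℝ → ℝ}
    (hX : IsCharacteristic u T X) {s t : ℝ} (hs : s ∈ Ico 0 T) (hst : s ≤ t) (ht : t ∈ Ico 0 T)
    (hneg : eField ρ u s (X s) < 0) : eField ρ u t (X t) ≤ eField ρ u s (X s) := by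
  have h0 : eField ρ u 0 (X 0) < 0 := by
    rw [← h.sol.e_mul_stretch h.smooth h.bdd hX hs]
    exact mul_neg_of_neg_of_pos hneg (stretch_pos _ _ _)
  have hsub : Icc s t ⊆ Ico 0 T := fun r hr => ⟨hs.1.trans hr.1, hr.2.trans_lt ht.2⟩
  have hd := fun r (hr : r ∈ Icc s t) =>
    (h.sol.transport_e h.smooth h.bdd X hX r (hsub hr)).mono hsub
  refine antitoneOn_of_hasDerivWithinAt_nonpos (convex_Icc s t)
    (fun r hr => (hd r hr).continuousWithinAt)
    (fun r hr => (hd r (interior_subset hr)).mono interior_subset) (fun r hr => ?_)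
    (left_mem_Icc.2 hst) (right_mem_Icc.2 hst) hst
  have hr' := hsub (interior_subset hr)
  have h1 : eField ρ u r (X r) ≤ 0 := by
    by_contra! hpos
    have := mul_pos hpos (stretch_pos u X r)
    rw [h.sol.e_mul_stretch h.smooth h.bdd hX hr'] at this
    linarith
  exact mul_nonpos_of_nonneg_of_nonpos (by linarith [(h.bounds r hr' (X r)).1]) h1

/-- If no bounded continuation exists, then the infimum of `e` tends to `-∞`: otherwise, because
negative values of `e` decrease along characteristics, `e` would be bounded below on all of
`[0, T) × ℝ`. -/
theorem tendsto_iInf_e (h : IsControlledSolution f T ρ u M V E C₀)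
    (hmax : IsMaximalBounded f T ρ u) :
    Tendsto (fun t => ⨅ x, eField ρ u t x) (𝓝[<] T) atBot := by
  by_contra hcon
  rw [tendsto_atBot] at hcon
  push Not at hcon
  obtain ⟨b, hb⟩ := hcon
  have hbdd : ∀ t ∈ Ico 0 T, BddBelow (range fun x => eField ρ u t x) := by
    intro t ht
    obtain ⟨B, hB⟩ := h.bdd t ht
    refine ⟨-(2 * B), ?_⟩
    rintro _ ⟨x, rfl⟩
    obtain ⟨h1, -, -, h4⟩ := hB t ⟨ht.1, le_rfl⟩ x
    have := abs_le.1 h1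
    have := abs_le.1 h4
    simp only [eField]
    linarith
  have hlow : ∀ t ∈ Ico 0 T, ∀ x, -max (-b) 0 ≤ eField ρ u t x := by
    intro t ht x
    by_contra! hlt
    have hneg : eField ρ u t x < 0 := hlt.trans_le (by simp)
    obtain ⟨t', hbt', ht'⟩ := (hb.and_eventually (Ioo_mem_nhdsLT ht.2)).exists
    have ht'' : t' ∈ Ico 0 T := ⟨ht.1.trans ht'.1.le, ht'.2⟩
    obtain ⟨X, hX, rfl⟩ := h.isSpeed_u.exists_characteristic ht x
    have h1 := h.e_le_of_le hX ht ht'.1.le ht'' hneg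
    have h2 := ciInf_le (hbdd t' ht'') (X t')
    have h3 := le_max_left (-b) 0
    linarith
  obtain ⟨A, hA⟩ := h.exists_bound (max (-b) 0)
  have hA' := fun c => hA c fun t ht x _ => hlow t ht x
  obtain ⟨h1, h2⟩ := h.sol.exists_continuation h.smooth h.bdd h.c1_e h.pos
    (fun t ht x => (h.speeds t ht x).1) fun c => ⟨A, hA' c⟩
  refine hmax ⟨_, _, h1, h2 (max V (2 * A)) fun t ht x => ?_⟩
  obtain ⟨k1, k2, k3, -⟩ := hA' x t ht x (by simp)
  have hA0 : 0 ≤ A := (abs_nonneg _).trans k1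
  have hux : deriv (u t) x = eField ρ u t x - ρ t x := by simp [eField]
  have k4 := abs_sub_le_two_mul k2 k1
  rw [← hux] at k4
  have hle := le_max_right V (2 * A)
  exact ⟨by linarith, (h.speeds t ht x).1.trans (le_max_left _ _), by linarith, k4.trans hle⟩

/-- The bound of the time derivative of the stretching along all characteristics. -/
noncomputable def stretchRate (T M E : ℝ) : ℝ := E + M * (1 + E * T)

lemma stretch_le (h : IsControlledSolution f T ρ u M V E C₀) {X : ℝ → ℝ}
    (hX : IsCharacteristic u T X) {t : ℝ} (ht : t ∈ Ico 0 T) : stretch u X t ≤ 1 + E * T := by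
  have h1 := h.sol.stretch_le h.smooth h.bdd (fun x => (h.bounds 0 h.zero_mem x).1) hX ht
  have h2 : eField ρ u 0 (X 0) * t ≤ E * T :=
    (mul_le_mul_of_nonneg_right ((le_abs_self _).trans (h.initial_e _)) ht.1).trans
      (mul_le_mul_of_nonneg_left ht.2.le h.E_nonneg)
  linarith

lemma abs_stretch_sub_le (h : IsControlledSolution f T ρ u M V E C₀) {X : ℝ → ℝ}
    (hX : IsCharacteristic u T X) {s t : ℝ} (hs : 0 ≤ s) (hst : s ≤ t) (ht : t < T) :
    |stretch u X t - stretch u X s| ≤ stretchRate T M E * (t - s) := by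
  have hsub : Icc s t ⊆ Ico 0 T := fun r hr => ⟨hs.trans hr.1, hr.2.trans_lt ht⟩
  have := (convex_Icc s t).norm_image_sub_le_of_norm_hasDerivWithin_le (C := stretchRate T M E)
    (fun r hr => (h.sol.hasDerivWithinAt_stretch h.smooth h.bdd hX (hsub hr)).mono hsub)
    (fun r hr => ?_) (left_mem_Icc.2 hst) (right_mem_Icc.2 hst)
  · simpa [Real.norm_eq_abs, abs_of_nonneg (sub_nonneg.2 hst)] using this
  · obtain ⟨h1, h2, -⟩ := h.bounds r (hsub hr) (X r)
    refine (norm_sub_le _ _).trans (add_le_add (h.initial_e _) ?_)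
    refine abs_mul_le_mul (abs_le.2 ⟨by linarith, h2⟩) ?_
    rw [abs_of_pos (stretch_pos _ _ _)]
    exact h.stretch_le hX (hsub hr)

/-- `X` is a characteristic along which the stretching vanishes at the time `T`. -/
def IsDegenerate (u : ℝ → ℝ → ℝ) (T M E : ℝ) (X : ℝ → ℝ) : Prop :=
  ∀ s ∈ Ico 0 T, stretch u X s ≤ stretchRate T M E * (T - s)

lemma tendsto_rate (B T : ℝ) : Tendsto (fun s => B * (T - s)) (𝓝[<] T) (𝓝 0) := by
  have : Tendsto (fun s => B * (T - s)) (𝓝[<] T) (𝓝 (B * (T - T))) :=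
    (Continuous.tendsto (by fun_prop) T).mono_left nhdsWithin_le_nhds
  simpa using this

/-- Where `e₀ ≥ 0`, the stretching is at least `exp (-M T)`. -/
lemma IsDegenerate.e_neg (h : IsControlledSolution f T ρ u M V E C₀) {X : ℝ → ℝ}
    (hX : IsCharacteristic u T X) (hdeg : IsDegenerate u T M E X) : eField ρ u 0 (X 0) < 0 := by
  by_contra! h0
  have hlow : ∀ s ∈ Ico 0 T, Real.exp (-(M * T)) ≤ stretch u X s := by
    intro s hs
    have hsub : Icc 0 s ⊆ Ico 0 T := fun r hr => ⟨hr.1, hr.2.trans_lt hs.2⟩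
    have h1 := abs_le_exp_mul_abs_right (L := M) hs.1
      (fun r hr => (h.sol.hasDerivWithinAt_stretch h.smooth h.bdd hX (hsub hr)).mono hsub)
      fun r hr => ?_
    · rw [stretch_zero, abs_one, abs_of_pos (stretch_pos _ _ _), sub_zero] at h1
      have h2 : Real.exp (M * s) ≤ Real.exp (M * T) :=
        Real.exp_le_exp.2 (mul_le_mul_of_nonneg_left hs.2.le h.M_nonneg)
      rw [Real.exp_neg, inv_le_iff_one_le_mul₀ (Real.exp_pos _), mul_comm]
      exact h1.trans (mul_le_mul_of_nonneg_right h2 (stretch_pos _ _ _).le)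
    · obtain ⟨-, h2, -⟩ := h.bounds r (hsub hr) (X r)
      have h3 := stretch_pos u X r
      have h4 := mul_nonneg h3.le h0
      have h5 : ρ r (X r) * stretch u X r ^ 2 ≤ M * stretch u X r ^ 2 :=
        mul_le_mul_of_nonneg_right h2 (sq_nonneg _)
      nlinarith
  obtain ⟨s, h1, h2⟩ := (((tendsto_rate (stretchRate T M E) T).eventually
    (gt_mem_nhds (Real.exp_pos (-(M * T))))).and (Ico_mem_nhdsLT h.pos)).exists
  linarith [hlow s h2, hdeg s h2]

lemma IsDegenerate.tendsto_e (h : IsControlledSolution f T ρ u M V E C₀) {X : ℝ → ℝ}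
    (hX : IsCharacteristic u T X) (hdeg : IsDegenerate u T M E X) :
    Tendsto (fun t => eField ρ u t (X t)) (𝓝[<] T) atBot := by
  have hmem := Ico_mem_nhdsLT h.pos
  have h1 : Tendsto (stretch u X) (𝓝[<] T) (𝓝[>] 0) := by
    refine tendsto_nhdsWithin_iff.2 ⟨?_, Eventually.of_forall fun t => stretch_pos u X t⟩
    refine tendsto_of_tendsto_of_tendsto_of_le_of_le' tendsto_const_nhds
      (tendsto_rate (stretchRate T M E) T)
      (Eventually.of_forall fun t => (stretch_pos u X t).le) ?_
    filter_upwards [hmem] with t ht using hdeg t ht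
  refine ((tendsto_inv_nhdsGT_zero.comp h1).const_mul_atTop_of_neg
    (IsDegenerate.e_neg h hX hdeg)).congr' ?_
  filter_upwards [hmem] with t ht
  rw [← h.sol.e_mul_stretch h.smooth h.bdd hX ht, Function.comp, mul_assoc,
    mul_inv_cancel₀ (stretch_pos u X t).ne', mul_one]

section Flow

variable {Z : ℝ → ℝ → ℝ}

lemma continuous_stretch (h : IsControlledSolution f T ρ u M V E C₀)
    (hZ : ∀ b, IsCharacteristic u T (Z b)) (hZ0 : ∀ b, Z b 0 = b) {t : ℝ} (ht : t ∈ Ico 0 T) :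
    Continuous fun b => stretch u (Z b) t := by
  obtain ⟨B, hB⟩ := h.isSpeed_u.bdd t ht
  refine Real.continuous_exp.comp (intervalIntegral.continuous_of_dominated_interval
    (bound := fun _ => B) (fun b => ?_) (fun b => ?_) intervalIntegrable_const ?_)
  · exact aestronglyMeasurable_of_continuousOn_Ico (continuousOn_along
      (w := fun t x => deriv (u t) x) h.isSpeed_u.cont_deriv (hZ b).continuousOn) ht
  · exact Eventually.of_forall fun s hs => (hB s (uIoc_subset_Ico ht hs).1 _).2
  · refine Eventually.of_forall fun s hs => ?_
    have hs2 := (uIoc_subset_Ico ht hs).2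
    have h1 : Continuous (deriv (u s)) :=
      continuousOn_univ.1 (h.isSpeed_u.cont_deriv.comp (f := fun y => (s, y)) (by fun_prop)
        fun y _ => by simpa using hs2)
    exact h1.comp (flow_continuous h.isSpeed_u hZ hZ0 hs2)

/-- Where the stretching comes arbitrarily close to `0` near `(T, a)`, the characteristic from `a`
is degenerate, since the stretching is Lipschitz in time uniformly in the starting point. -/
lemma isDegenerate_of_frequently (h : IsControlledSolution f T ρ u M V E C₀)
    (hZ : ∀ b, IsCharacteristic u T (Z b)) (hZ0 : ∀ b, Z b 0 = b) {a : ℝ}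
    (ha : ∀ ε > 0, ∃ t ∈ Ico 0 T, T - ε < t ∧ ∃ b, |b - a| < ε ∧ stretch u (Z b) t < ε) :
    IsDegenerate u T M E (Z a) := by
  intro s hs
  refine le_of_forall_pos_lt_add fun η hη => ?_
  obtain ⟨δ, hδ, hcont⟩ := Metric.continuous_iff.1 (h.continuous_stretch hZ hZ0 hs) a (η / 2)
    (by positivity)
  obtain ⟨t, ht, hεt, b, hb, hbt⟩ := ha (min δ (min (T - s) (η / 2)))
    (lt_min hδ (lt_min (by linarith [hs.2]) (by positivity)))
  have h1 := hcont b (hb.trans_le (min_le_left _ _))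
  have h2 : min δ (min (T - s) (η / 2)) ≤ T - s := (min_le_right _ _).trans (min_le_left _ _)
  have h3 : min δ (min (T - s) (η / 2)) ≤ η / 2 := (min_le_right _ _).trans (min_le_right _ _)
  have hst : s ≤ t := by linarith
  have h4 := abs_le.1 (h.abs_stretch_sub_le (hZ b) hs.1 hst ht.2)
  have hB0 : 0 ≤ stretchRate T M E :=
    add_nonneg h.E_nonneg (mul_nonneg h.M_nonneg (by
      have := mul_nonneg h.E_nonneg h.pos.le; linarith))
  have h5 : stretchRate T M E * (t - s) ≤ stretchRate T M E * (T - s) :=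
    mul_le_mul_of_nonneg_left (by linarith [ht.2]) hB0
  rw [Real.dist_eq] at h1
  have h6 := abs_lt.1 h1
  linarith [h4.1, h6.1]

/-- If the solution cannot be continued, then `e` is unbounded below on a domain of dependence, and
the starting points of the characteristics that lead to its large negative values accumulate at a
point whose characteristic is degenerate. -/
lemma exists_isDegenerate (h : IsControlledSolution f T ρ u M V E C₀)
    (hZ : ∀ b, IsCharacteristic u T (Z b)) (hZ0 : ∀ b, Z b 0 = b)
    (hbreak : BreaksDownAt f T ρ u) : ∃ a, IsDegenerate u T M E (Z a) := by
  obtain ⟨c, hc⟩ : ∃ c, ∀ K, ∃ t ∈ Ico 0 T, ∃ x, |x - c| ≤ 1 + V * (T - t) ∧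
      eField ρ u t x < -K := by
    by_contra! hcon
    refine hbreak ⟨_, _, (h.sol.exists_continuation h.smooth h.bdd h.c1_e h.pos
      (fun t ht x => (h.speeds t ht x).1) fun c => ?_).1⟩
    obtain ⟨K, hK⟩ := hcon c
    obtain ⟨A, hA⟩ := h.exists_bound K
    exact ⟨A, hA c hK⟩
  choose t ht x hx hex using fun n : ℕ => hc n
  have hfoot : ∀ n, ∃ b, Z b (t n) = x n := by
    intro n
    obtain ⟨X, hX, hX1⟩ := h.isSpeed_u.exists_characteristic (ht n) (x n)
    exact ⟨X 0, by rw [← hX1]; exact h.isSpeed_u.eqOn (hZ _) hX h.zero_mem (hZ0 _) (ht n)⟩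
  choose a ha using hfoot
  have hacpt : ∀ n, a n ∈ Icc (c - (1 + 2 * (V * T))) (c + (1 + 2 * (V * T))) := by
    intro n
    have h1 := (hZ (a n)).abs_sub_le_mul le_rfl (ht n).1 (ht n).2
      fun r hr => (h.speeds r ⟨hr.1, hr.2.trans_lt (ht n).2⟩ _).1
    rw [ha, hZ0, sub_zero] at h1
    have h2 : V * t n ≤ V * T := mul_le_mul_of_nonneg_left (ht n).2.le h.V_nonneg
    have h3 : V * (T - t n) ≤ V * T :=
      mul_le_mul_of_nonneg_left (by linarith [(ht n).1]) h.V_nonneg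
    have h4 := abs_le.1 h1
    have h5 := abs_le.1 (hx n)
    exact ⟨by linarith [h4.2, h5.1], by linarith [h4.1, h5.2]⟩
  obtain ⟨a', -, φ, hφ, hlim⟩ := isCompact_Icc.tendsto_subseq hacpt
  refine ⟨a', h.isDegenerate_of_frequently hZ hZ0 fun ε hε => ?_⟩
  -- `e` is bounded before the time `τ`
  set τ := max 0 (T - ε) with hτ
  have hτm : τ ∈ Ico 0 T := ⟨le_max_left _ _, max_lt h.pos (by linarith)⟩
  obtain ⟨B, hB⟩ := h.bdd τ hτm
  have hφ' : Tendsto (fun n => ((φ n : ℕ) : ℝ)) atTop atTop :=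
    tendsto_natCast_atTop_atTop.comp hφ.tendsto_atTop
  obtain ⟨n, ⟨hn1, hn2⟩, hn3⟩ := (((hφ'.eventually_gt_atTop (max (2 * B) 0)).and
    (hφ'.eventually_gt_atTop (E / ε))).and (Metric.tendsto_nhds.1 hlim ε hε)).exists
  have hpos : (0 : ℝ) < φ n := (le_max_right _ _).trans_lt hn1
  refine ⟨t (φ n), ht _, ?_, a (φ n), hn3, ?_⟩
  · by_contra! hle
    obtain ⟨h1, -, -, h4⟩ := hB (t (φ n)) ⟨(ht _).1, hle.trans (le_max_right _ _)⟩ (x (φ n))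
    have h5 := hex (φ n)
    have h6 := (le_max_left _ _).trans_lt hn1
    simp only [eField] at h5
    linarith [(abs_le.1 h1).1, (abs_le.1 h4).1]
  · have h1 := h.sol.e_mul_stretch h.smooth h.bdd (hZ (a (φ n))) (ht (φ n))
    rw [ha, hZ0] at h1
    have h2 := (abs_le.1 (h.initial_e (a (φ n)))).1
    have h3 := stretch_pos u (Z (a (φ n))) (t (φ n))
    have h4 := hex (φ n)
    have h5 : φ n * stretch u (Z (a (φ n))) (t (φ n)) ≤ E := by nlinarith
    rw [div_lt_iff₀ hε] at hn2
    by_contra! hle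
    have := mul_le_mul_of_nonneg_left hle hpos.le
    linarith

lemma hasDerivAt_flow_u (h : IsControlledSolution f T ρ u M V E C₀)
    (hZ : ∀ b, IsCharacteristic u T (Z b)) (hZ0 : ∀ b, Z b 0 = b) {t : ℝ} (ht : t ∈ Ico 0 T)
    (a : ℝ) : HasDerivAt (fun b => Z b t) (stretch u (Z a) t) a :=
  hasDerivAt_flow h.isSpeed_u hZ hZ0 ht a

lemma monotone_flow (h : IsControlledSolution f T ρ u M V E C₀)
    (hZ : ∀ b, IsCharacteristic u T (Z b)) (hZ0 : ∀ b, Z b 0 = b) {t : ℝ} (ht : t ∈ Ico 0 T) :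
    Monotone fun b => Z b t :=
  monotone_of_hasDerivAt_nonneg (fun b => h.hasDerivAt_flow_u hZ hZ0 ht b)
    fun _ => (stretch_pos _ _ _).le

/-- Between two characteristics that are close at the time `t` there is one with small stretching. -/
lemma exists_stretch_mul_le (h : IsControlledSolution f T ρ u M V E C₀)
    (hZ : ∀ b, IsCharacteristic u T (Z b)) (hZ0 : ∀ b, Z b 0 = b) {t p q c d : ℝ}
    (ht : t ∈ Ico 0 T) (hpq : p < q) (hp : |Z p t - c| ≤ d) (hq : |Z q t - c| ≤ d) :
    ∃ ξ ∈ Ioo p q, stretch u (Z ξ) t * (q - p) ≤ 2 * d := by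
  obtain ⟨ξ, hξ, heq⟩ := exists_hasDerivAt_eq_slope (fun b => Z b t)
    (fun b => stretch u (Z b) t) hpq
    (fun b _ => (h.hasDerivAt_flow_u hZ hZ0 ht b).continuousAt.continuousWithinAt)
    (fun b _ => h.hasDerivAt_flow_u hZ hZ0 ht b)
  refine ⟨ξ, hξ, ?_⟩
  rw [heq, div_mul_cancel₀ _ (sub_ne_zero.2 hpq.ne')]
  linarith [(abs_le.1 hp).1, (abs_le.1 hq).2]

/-- If two characteristics reach the same point at the time `T`, both are degenerate, because the
interval between them is compressed to that point. -/
lemma isDegenerate_of_meet (h : IsControlledSolution f T ρ u M V E C₀)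
    (hZ : ∀ b, IsCharacteristic u T (Z b)) (hZ0 : ∀ b, Z b 0 = b) {a a' c : ℝ} (hne : a ≠ a')
    (ha : ∀ t ∈ Ico 0 T, |Z a t - c| ≤ V * (T - t))
    (ha' : ∀ t ∈ Ico 0 T, |Z a' t - c| ≤ V * (T - t)) : IsDegenerate u T M E (Z a') := by
  refine h.isDegenerate_of_frequently hZ hZ0 fun ε hε => ?_
  have hbetween : ∀ b, b ∈ uIcc a a' → ∀ t ∈ Ico 0 T, |Z b t - c| ≤ V * (T - t) := by
    intro b hb t ht
    have hmono := h.monotone_flow hZ hZ0 ht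
    have h1 := abs_le.1 (ha t ht)
    have h2 := abs_le.1 (ha' t ht)
    rcases mem_uIcc.1 hb with ⟨h3, h4⟩ | ⟨h3, h4⟩
    · exact abs_le.2 ⟨by linarith [h1.1, hmono h3], by linarith [h2.2, hmono h4]⟩
    · exact abs_le.2 ⟨by linarith [h2.1, hmono h3], by linarith [h1.2, hmono h4]⟩
  -- starting points close to `a'` between `a` and `a'`
  obtain ⟨p, q, hpq, hp, hq, hball⟩ : ∃ p q, p < q ∧ p ∈ uIcc a a' ∧ q ∈ uIcc a a' ∧
      ∀ ξ ∈ Ioo p q, |ξ - a'| < ε := by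
    rcases lt_or_gt_of_ne hne with hlt | hlt
    · refine ⟨max a (a' - ε), a', max_lt hlt (by linarith), ?_, right_mem_uIcc, fun ξ hξ => ?_⟩
      · exact mem_uIcc.2 (Or.inl ⟨le_max_left _ _, max_le hlt.le (by linarith)⟩)
      · exact abs_lt.2 ⟨by linarith [(le_max_right _ _).trans_lt hξ.1], by linarith [hξ.2]⟩
    · refine ⟨a', min a (a' + ε), lt_min hlt (by linarith), right_mem_uIcc, ?_, fun ξ hξ => ?_⟩
      · exact mem_uIcc.2 (Or.inr ⟨le_min hlt.le (by linarith), min_le_left _ _⟩)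
      · exact abs_lt.2 ⟨by linarith [hξ.1], by linarith [hξ.2.trans_le (min_le_right _ _)]⟩
  obtain ⟨t, h1, ht, h2⟩ := (((tendsto_rate (2 * V) T).eventually
    (gt_mem_nhds (mul_pos hε (sub_pos.2 hpq)))).and (inter_mem
      (Ico_mem_nhdsLT h.pos) (Ioo_mem_nhdsLT (by linarith : T - ε < T)))).exists
  obtain ⟨ξ, hξ, hle⟩ := h.exists_stretch_mul_le hZ hZ0 ht hpq (hbetween p hp t ht)
    (hbetween q hq t ht)
  refine ⟨t, ht, h2.1, ξ, hball ξ hξ, ?_⟩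
  refine lt_of_mul_lt_mul_right (hle.trans_lt ?_) (sub_pos.2 hpq).le
  linarith

/-- At the end point `c` of a degenerate characteristic, `e(t, c)` tends to `-∞`: the starting
points of the characteristics through `(t, c)` accumulate only at starting points of degenerate
characteristics. -/
lemma tendsto_e_endpoint (h : IsControlledSolution f T ρ u M V E C₀)
    (hZ : ∀ b, IsCharacteristic u T (Z b)) (hZ0 : ∀ b, Z b 0 = b) {a c : ℝ}
    (hdeg : IsDegenerate u T M E (Z a)) (hac : ∀ t ∈ Ico 0 T, |Z a t - c| ≤ V * (T - t)) :
    Tendsto (fun t => eField ρ u t c) (𝓝[<] T) atBot := by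
  by_contra hcon
  rw [tendsto_atBot] at hcon
  push Not at hcon
  obtain ⟨b, hb⟩ := hcon
  set K := max (-b) 0 with hK
  have hseq : ∀ n : ℕ, ∃ t ∈ Ico 0 T, T - 1 / ((n : ℝ) + 1) < t ∧ -K < eField ρ u t c := by
    intro n
    obtain ⟨t, hbt, ht1, ht2⟩ := (hb.and_eventually (inter_mem (Ico_mem_nhdsLT h.pos)
      (Ioo_mem_nhdsLT (sub_lt_self T (by positivity : (0 : ℝ) < 1 / ((n : ℝ) + 1)))))).exists
    exact ⟨t, ht1, ht2.1, by linarith [le_max_left (-b) 0]⟩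
  choose t ht htn hte using hseq
  have htlim : Tendsto t atTop (𝓝 T) := by
    refine tendsto_of_tendsto_of_tendsto_of_le_of_le (g := fun n : ℕ => T - 1 / ((n : ℝ) + 1))
      (h := fun _ => T) ?_ tendsto_const_nhds (fun n => (htn n).le) (fun n => (ht n).2.le)
    simpa using tendsto_const_nhds.sub (tendsto_one_div_add_atTop_nhds_zero_nat (𝕜 := ℝ))
  have hfoot : ∀ n, ∃ b, Z b (t n) = c := by
    intro n
    obtain ⟨X, hX, hX1⟩ := h.isSpeed_u.exists_characteristic (ht n) c
    exact ⟨X 0, by rw [← hX1]; exact h.isSpeed_u.eqOn (hZ _) hX h.zero_mem (hZ0 _) (ht n)⟩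
  choose d hd using hfoot
  have hdcpt : ∀ n, d n ∈ Icc (c - V * T) (c + V * T) := by
    intro n
    have h1 := (hZ (d n)).abs_sub_le_mul le_rfl (ht n).1 (ht n).2
      fun r hr => (h.speeds r ⟨hr.1, hr.2.trans_lt (ht n).2⟩ _).1
    rw [hd, hZ0, sub_zero] at h1
    have h2 : V * t n ≤ V * T := mul_le_mul_of_nonneg_left (ht n).2.le h.V_nonneg
    have h4 := abs_le.1 h1
    exact ⟨by linarith [h4.2], by linarith [h4.1]⟩
  obtain ⟨a', -, φ, hφ, hlim⟩ := isCompact_Icc.tendsto_subseq hdcpt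
  have htφ : Tendsto (fun n => t (φ n)) atTop (𝓝 T) := htlim.comp hφ.tendsto_atTop
  have hac' : ∀ s ∈ Ico 0 T, |Z a' s - c| ≤ V * (T - s) := by
    intro s hs
    have hl : Tendsto (fun n => |Z (d (φ n)) s - c|) atTop (𝓝 |Z a' s - c|) :=
      ((((flow_continuous h.isSpeed_u hZ hZ0 hs).tendsto a').comp hlim).sub_const c).abs
    refine le_of_tendsto hl ?_
    filter_upwards [htφ.eventually (lt_mem_nhds hs.2)] with n hn
    have h1 := (hZ (d (φ n))).abs_sub_le_mul hs.1 hn.le (ht (φ n)).2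
      fun r hr => (h.speeds r ⟨hs.1.trans hr.1, hr.2.trans_lt (ht (φ n)).2⟩ _).1
    rw [hd, abs_sub_comm] at h1
    exact h1.trans (mul_le_mul_of_nonneg_left (by linarith [(ht (φ n)).2]) h.V_nonneg)
  have hdeg' : IsDegenerate u T M E (Z a') := by
    rcases eq_or_ne a a' with rfl | hne
    · exact hdeg
    · exact h.isDegenerate_of_meet hZ hZ0 hne hac hac'
  have hneg := IsDegenerate.e_neg h (hZ a') hdeg'
  rw [hZ0] at hneg
  have he0 : Continuous (eField ρ u 0) := continuousOn_univ.1 (h.c1_e.continuousOn.comp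
    (f := fun y => ((0 : ℝ), y)) (by fun_prop) fun y _ => by simpa using h.pos)
  have hK0 : 0 ≤ K := le_max_right _ _
  -- `e(t, c) ≥ -K` means `e₀ ≥ -K P` at the starting points, and `P` is small
  have key : ∀ s ∈ Ico 0 T, -(K * (2 * stretchRate T M E * (T - s))) ≤ eField ρ u 0 a' := by
    intro s hs
    have h1 : Tendsto (fun n => -(K * (stretch u (Z (d (φ n))) s
        + stretchRate T M E * (t (φ n) - s)))) atTop
        (𝓝 (-(K * (stretch u (Z a') s + stretchRate T M E * (T - s))))) :=
      (((((h.continuous_stretch hZ hZ0 hs).tendsto a').comp hlim).add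
        ((htφ.sub_const s).const_mul _)).const_mul K).neg
    have h2 := le_of_tendsto_of_tendsto h1 ((he0.tendsto a').comp hlim) (by
      filter_upwards [htφ.eventually (lt_mem_nhds hs.2)] with n hn
      have h3 := (abs_le.1 (h.abs_stretch_sub_le (hZ (d (φ n))) hs.1 hn.le (ht (φ n)).2)).2
      have h4 := h.sol.e_mul_stretch h.smooth h.bdd (hZ (d (φ n))) (ht (φ n))
      rw [hd, hZ0] at h4
      have h5 := mul_le_mul_of_nonneg_right (hte (φ n)).le
        (stretch_pos u (Z (d (φ n))) (t (φ n))).le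
      have h6 := mul_le_mul_of_nonneg_left h3 hK0
      simp only [Function.comp]
      linarith)
    have h7 := mul_le_mul_of_nonneg_left (hdeg' s hs) hK0
    linarith
  have h8 := le_of_tendsto_of_tendsto (tendsto_rate (-(K * (2 * stretchRate T M E))) T)
    (tendsto_const_nhds (x := eField ρ u 0 a')) (by
      filter_upwards [Ico_mem_nhdsLT h.pos] with s hs
      have := key s hs
      linarith)
  linarith

lemma exists_endpoint (h : IsControlledSolution f T ρ u M V E C₀) {X : ℝ → ℝ}
    (hX : IsCharacteristic u T X) :
    ∃ c, Tendsto X (𝓝[<] T) (𝓝 c) ∧ ∀ t ∈ Ico 0 T, |X t - c| ≤ V * (T - t) := by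
  have hlip : LipschitzOnWith V.toNNReal X (Ico 0 T) := by
    refine (convex_Ico 0 T).lipschitzOnWith_of_nnnorm_hasDerivWithin_le (fun t ht => hX t ht)
      fun t ht => ?_
    rw [← NNReal.coe_le_coe, Real.coe_toNNReal _ h.V_nonneg, coe_nnnorm]
    exact (h.speeds t ht _).1
  obtain ⟨Y, hY, hXY⟩ := hlip.extend_real
  refine ⟨Y T, ?_, fun t ht => ?_⟩
  · refine ((hY.continuous.tendsto T).mono_left nhdsWithin_le_nhds).congr' ?_
    filter_upwards [Ico_mem_nhdsLT h.pos] with t ht using (hXY ht).symm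
  · have := hY.dist_le_mul t T
    rw [Real.dist_eq, Real.dist_eq, Real.coe_toNNReal _ h.V_nonneg, abs_sub_comm t T,
      abs_of_nonneg (by linarith [ht.2] : 0 ≤ T - t)] at this
    rwa [hXY ht]

end Flow

/-- At the breakdown time there is a point `c` at which `e` tends to `-∞`, and a characteristic that
ends there along which `e` tends to `-∞`. -/
theorem exists_blowup_point (h : IsControlledSolution f T ρ u M V E C₀)
    (hbreak : BreaksDownAt f T ρ u) :
    ∃ c, Tendsto (fun t => eField ρ u t c) (𝓝[<] T) atBot ∧
      ∃ X, IsCharacteristic u T X ∧ Tendsto X (𝓝[<] T) (𝓝 c) ∧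
        Tendsto (fun t => eField ρ u t (X t)) (𝓝[<] T) atBot := by
  obtain ⟨Z, hZ, hZ0⟩ := h.isSpeed_u.exists_flow h.pos
  obtain ⟨a, ha⟩ := h.exists_isDegenerate hZ hZ0 hbreak
  obtain ⟨c, hc, hac⟩ := h.exists_endpoint (hZ a)
  exact ⟨c, h.tendsto_e_endpoint hZ hZ0 ha hac, Z a, hZ a, hc, IsDegenerate.tendsto_e h (hZ a) ha⟩

end IsControlledSolution

end Blowup

lemma IsCb.exists_abs_le {k : ℕ} {g : ℝ → ℝ} (hg : IsCb k g) {i : ℕ} (hi : i ≤ k) :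
    ∃ C, 0 ≤ C ∧ ∀ x, |iteratedDeriv i g x| ≤ C := by
  obtain ⟨C, hC⟩ := hg.2 i hi
  exact ⟨C, (abs_nonneg _).trans (hC 0), hC⟩

theorem proposition3p5
    (f : ℝ → ℝ) (hf : ContDiff ℝ ∞ f)
    (ρ₀ u₀ : ℝ → ℝ) (hρ₀ : IsCb 1 ρ₀) (hu₀ : IsCb 1 u₀) (hρ₀_nonneg : ∀ x, 0 ≤ ρ₀ x)
    (T : ℝ) (hT : 0 < T) (ρ u : ℝ → ℝ → ℝ)
    (hsol : IsClassicalSolution f ρ₀ u₀ T ρ u)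
    (hfu : ∀ t ∈ Ico 0 T, ∀ x, deriv f (u t x) ≤ 0) :
    (∀ M : ℝ, (∀ x, ρ₀ x ∈ Icc 0 M ∧ deriv u₀ x + ρ₀ x ∈ Icc 0 M) →
      ∀ t ∈ Ico 0 T, ∀ x, ρ t x ∈ Icc 0 M ∧ eField ρ u t x ∈ Icc 0 M) ∧
    (∀ xs : ℝ, deriv u₀ xs + ρ₀ xs < 0 →
      T ≤ -1 / (deriv u₀ xs + ρ₀ xs) ∧
      (IsCb 2 u₀ → IsC1On (Ico 0 T) (eField ρ u) →
        (IsMaximalBounded f T ρ u →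
          Tendsto (fun t => ⨅ x, eField ρ u t x) (𝓝[<] T) atBot) ∧
        (BreaksDownAt f T ρ u →
          ∃ xc : ℝ, Tendsto (fun t => eField ρ u t xc) (𝓝[<] T) atBot ∧
            ∃ X : ℝ → ℝ, IsCharacteristic u T X ∧ Tendsto X (𝓝[<] T) (𝓝 xc) ∧
              Tendsto (fun t => eField ρ u t (X t)) (𝓝[<] T) atBot))) := by
  obtain ⟨hs, hb, rfl, rfl⟩ := hsol
  refine ⟨fun M hM t ht x => ?_, fun xs hxs => ⟨hs.lifespan_le hf hb hρ₀_nonneg hT hxs, ?_⟩⟩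
  · have hM0 : 0 ≤ M := (hM 0).1.1.trans (hM 0).1.2
    have h1 := hs.le_of_initial_le hf hb hfu hρ₀_nonneg hM0
      (fun x => ⟨(hM x).1.2, (hM x).2.2⟩) ht x
    exact ⟨⟨hs.rho_nonneg hf hb hρ₀_nonneg ht x, h1.1⟩,
      hs.e_nonneg hf hb (fun x => (hM x).2.1) ht x, h1.2⟩
  · intro hu₂ he
    obtain ⟨R₀, hR₀, hρ0⟩ := hρ₀.exists_abs_le (i := 0) (by norm_num)
    obtain ⟨R₁, hR₁, hρ1⟩ := hρ₀.exists_abs_le (i := 1) le_rfl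
    obtain ⟨U₀, hU₀, hu0⟩ := hu₂.exists_abs_le (i := 0) (by norm_num)
    obtain ⟨U₁, hU₁, hu1⟩ := hu₂.exists_abs_le (i := 1) (by norm_num)
    obtain ⟨U₂, hU₂, hu2⟩ := hu₂.exists_abs_le (i := 2) le_rfl
    simp only [iteratedDeriv_zero] at hρ0 hu0
    simp only [iteratedDeriv_one] at hρ1 hu1
    rw [iteratedDeriv_succ, iteratedDeriv_one] at hu2
    have he0 : ∀ x, |eField ρ u 0 x| ≤ U₁ + R₀ := fun x =>
      (abs_add_le _ _).trans (add_le_add (hu1 x) (hρ0 x))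
    have hM := fun t ht x => hs.le_of_initial_le hf hb hfu hρ₀_nonneg (M := U₁ + R₀)
      (by positivity) (fun x => ⟨by linarith [le_abs_self (ρ 0 x), hρ0 x],
        (le_abs_self _).trans (he0 x)⟩) (t := t) ht x
    obtain ⟨V, -, hV⟩ := hs.exists_abs_u_le hf hb hfu hT (by positivity : 0 ≤ U₁ + R₀)
      (fun t ht x => ⟨hs.rho_nonneg hf hb hρ₀_nonneg ht x, (hM t ht x).1⟩) hu0
    obtain ⟨F, -, hF⟩ := exists_abs_le_of_continuous hf.continuous V
    have hctrl : IsControlledSolution f T ρ u (U₁ + R₀) (max V F) (U₁ + R₀) (1 + R₁ + U₂) :=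
      { smooth := hf
        pos := hT
        sol := hs
        bdd := hb
        c1_e := he
        M_nonneg := by positivity
        bounds := fun t ht x => ⟨hs.rho_nonneg hf hb hρ₀_nonneg ht x, hM t ht x⟩
        speeds := fun t ht x => ⟨(hV t ht x).trans (le_max_left _ _),
          (hF _ (hV t ht x)).trans (le_max_right _ _)⟩
        initial_e := he0
        one_le := by linarith
        initial_gradient := fun x => by
          have hd : deriv (eField ρ u 0) x = deriv (deriv (u 0)) x + deriv (ρ 0) x := by
            have h2 : Differentiable ℝ (deriv (u 0)) :=
              ((contDiff_succ_iff_deriv (n := 1)).1 hu₂.1).2.2.differentiable one_ne_zero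
            exact deriv_add (h2 x) (hρ₀.1.differentiable one_ne_zero x)
          refine ⟨by linarith [hρ1 x], ?_⟩
          rw [hd]
          exact (abs_add_le _ _).trans (by linarith [hρ1 x, hu2 x]) }
    exact ⟨hctrl.tendsto_iInf_e, hctrl.exists_blowup_point⟩
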